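/- Let $M,n,d\in\mathbb N$ and let $F_{m,i}:\mathbb R^d\to\mathbb R^d$ ($m\in[M]$, $i\in[n]$), $F_m=\frac1n\sum_{i=1}^n F_{m,i}$, $F=\sum_{m=1}^M F_m$. Let $g:\mathbb R^d\to\mathbb R\cup\{+\infty\}$ be proper, lower semicontinuous and convex, and let $z^*\in\mathbb R^d$ solve the variational inequality $\langle F(z^*),z-z^*\rangle+g(z)-g(z^*)\ge 0$ for all $z\in\mathbb R^d$. Assume that there are $\mu,L,\overline L>0$ such that for all $m$ and all $u,v\in\mathbb R^d$ $$\|F_m(u)-F_m(v)\|\le L\|u-v\|,\quad \tfrac1n\sum_{i=1}^n\|F_{m,i}(u)-F_{m,i}(v)\|^2\le\overline L^2\|u-v\|^2,\quad \langle F_m(u)-F_m(v),u-v\rangle\ge\mu\|u-v\|^2 .$$ Network: $\mathcal G$ is a connected undirected graph on $[M]$ with a gossip matrix $\mathbf W\in\mathbb R^{M\times M}$, i.e. $\mathbf W$ is symmetric positive semidefinite, its kernel is exactly the span of $(1,\dots,1)$, $w_{ij}\ne0$ if and only if $i=j$ or $\{i,j\}$ is an edge, and $\lambda_{\max}(\mathbf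 W)=1$. Let $\chi=\lambda_{\max}(\mathbf W)/\lambda_{\min}^+(\mathbf W)$, where $\lambda_{\min}^+$ is the smallest positive eigenvalue. Notation on $(\mathbb R^d)^M$ (with the Euclidean norm): $\mathbf F(\mathbf z)=(F_1(z_1),\dots,F_M(z_M))$, $\mathbf g(\mathbf z)=\frac1M\sum_m g(z_m)$, $\mathbf z^*=(z^*,\dots,z^*)$, $\mathcal L=\{\mathbf z: z_1=\dots=z_M\}$, $\mathrm{prox}_{\eta\mathbf g}(\mathbf x)=\arg\min_{\mathbf v}\{\eta\,\mathbf g(\mathbf v)+\frac12\|\mathbf v-\mathbf x\|^2\}$, and, for indices $j=(j_1,\dots,j_M)\in[n]^M$, $\mathbf F_j(\mathbf z)=(F_{1,j_1}(z_1),\dots,F_{M,j_M}(z_M))$. Algorithm, with batch size $b\in\{1,\dots,n\}$ and probability $p$: choose $\mathbf z^0=\mathbf w^0\in(\mathrm{dom}\,g)^M$ and $\mathbf y^0\in\mathcal L^\perp$, and put $\mathbf z^{-1}=\mathbf z^0$, $\mathbf w^{-1}=\mathbf w^0$, $\mathbf y^{-1}=\mathbf y^0$. For $k=0,1,2,\dots$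 every worker $m$ draws two batches of $b$ indices from $[n]$, uniformly; $S^k$ and $S^{k+1/2}$ are the lists of the $b$ resulting index vectors in $[n]^M$; all draws, and the coins used below, are mutually independent. Then $$\delta^k=\tfrac1b\sum_{j\in S^k}\big(\mathbf F_j(\mathbf z^k)-\mathbf F_j(\mathbf w^{k-1})+\alpha[\mathbf F_j(\mathbf z^k)-\mathbf F_j(\mathbf z^{k-1})]\big)+\mathbf F(\mathbf w^{k-1}),\qquad \Delta^k=\delta^k-\big(\mathbf y^k+\alpha(\mathbf y^k-\mathbf y^{k-1})\big),$$ $$\mathbf z^{k+1}=\mathrm{prox}_{\eta\mathbf g}\big(\mathbf z^k+\gamma(\mathbf w^k-\mathbf z^k)-\eta\Delta^k\big),\qquad \Delta^{k+1/2}=\tfrac1b\sum_{j\in S^{k+1/2}}\big(\mathbf F_j(\mathbf z^{k+1})-\mathbf F_j(\mathbf w^k)\big)+\mathbf F(\mathbf w^k),$$ $$\mathbf y^{k+1}=\mathbf y^k-\theta(\mathbf W\otimes\mathbf I_d)\big(\mathbf z^{k+1}-\beta(\Delta^{k+1/2}-\mathbf y^k)\big),\qquad \mathbf w^{k+1}=\begin{cases}\mathbf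 z^k&\text{with probability }p,\\ \mathbf w^k&\text{with probability }1-p.\end{cases}$$ Tuning: $\gamma=p\in(0,\frac18]$, $\eta=\min\{\frac{\sqrt{\gamma b}}{4\overline L},\frac1{16L\sqrt\chi}\}$, $\beta=\min\{\frac{\mu}{4L^2},\frac{b\gamma}{4\eta\overline L^2}\}$, $\theta=\min\{\frac1{2\beta},\frac1{16\eta}\}$, $\alpha=\max\{1-\frac{\mu\eta}4,\ 1-\beta\theta\chi^{-1},\ 1-\frac{p\eta\mu}{2\gamma+\eta\mu}\}$. Theorem. The number of iterations needed for $\mathbb E\|\mathbf z^k-\mathbf z^*\|^2\le\varepsilon$ is $$O\Big(\Big[\frac1p+\chi+\frac1{\sqrt{pb}}\frac{\overline L}{\mu}+\sqrt\chi\,\frac L\mu\Big]\log\frac1\varepsilon\Big),$$ where $\log\frac1\varepsilon$ hides the size of the initial error as usual. Precisely: there is an absolute constant $C>0$ such that, for every problem, network, choice of $b,p$ and starting point as above, there is an $R>0$ (depending on these data, but not on $\varepsilon$, $k$ or the random choices) such that for every $\varepsilon>0$ and every integer $k\ge0$ with $$k\ \ge\ C\Big[\frac1p+\chi+\frac1{\sqrt{pb}}\frac{\overline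 L}{\mu}+\sqrt\chi\,\frac L\mu\Big]\log\frac R\varepsilon$$ the random variable $\|\mathbf z^k-\mathbf z^*\|^2$ is integrable and $\mathbb E\|\mathbf z^k-\mathbf z^*\|^2\le\varepsilon$. -/

import Mathlib

open MeasureTheory ProbabilityTheory

noncomputable section

namespace DecentralizedVI

/-- The space `ℝ^d` with the Euclidean norm. -/
abbrev Vec (d : ℕ) : Type := EuclideanSpace ℝ (Fin d)

/-- The product space `(ℝ^d)^M` with the Euclidean norm: `‖z‖² = ∑ m, ‖z m‖²`. -/
abbrev Stack (M d : ℕ) : Type := PiLp 2 (fun _ : Fin M => Vec d)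

/-- The consensus space of all `z` with `z_1 = ... = z_M`. -/
def consensus (M d : ℕ) : Submodule ℝ (Stack M d) where
  carrier := {z | ∀ i j : Fin M, z i = z j}
  add_mem' := by
    intro x y hx hy i j
    simp only [PiLp.add_apply, hx i j, hy i j]
  zero_mem' := by
    intro i j
    simp
  smul_mem' := by
    intro c x hx i j
    simp only [PiLp.smul_apply, hx i j]

/-- The stacked vector `(u, ..., u)`. -/
def diag (M : ℕ) {d : ℕ} (u : Vec d) : Stack M d := WithLp.toLp 2 (fun _ => u)

/-! ### The variational inequality -/

/-- `g : ℝ^d → ℝ ∪ {+∞}` is proper, lower semicontinuous and convex (its epigraph is convex). -/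
structure ProperLscConvex {d : ℕ} (g : Vec d → EReal) : Prop where
  ne_bot : ∀ u, g u ≠ ⊥
  exists_ne_top : ∃ u, g u ≠ ⊤
  lsc : LowerSemicontinuous g
  convex_epigraph : Convex ℝ {q : Vec d × ℝ | g q.1 ≤ (q.2 : EReal)}

/-- The local operator `F_m = (1/n) ∑ i, F_{m,i}`. -/
def localOp {M n d : ℕ} (F : Fin M → Fin n → Vec d → Vec d) (m : Fin M) (u : Vec d) : Vec d :=
  (n : ℝ)⁻¹ • ∑ i, F m i u

/-- The global operator `∑ m, F_m`. -/
def globalOp {M n d : ℕ} (F : Fin M → Fin n → Vec d → Vec d) (u : Vec d) : Vec d :=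
  ∑ m, localOp F m u

/-- `u` solves the variational inequality `⟨A u, v - u⟩ + g v - g u ≥ 0` for all `v`.  The term
`g u` is moved to the other side, which avoids a difference of infinities; for a proper `g` the
inequality forces `g u` to be finite. -/
def SolvesVI {d : ℕ} (A : Vec d → Vec d) (g : Vec d → EReal) (u : Vec d) : Prop :=
  ∀ v : Vec d, g u ≤ ((inner ℝ (A u) (v - u) : ℝ) : EReal) + g v

/-- Every `F_m` is `L`-Lipschitz, and every family `(F_{m,i})_i` is `Lbar`-average Lipschitz. -/
structure LipschitzAssumption {M n d : ℕ} (F : Fin M → Fin n → Vec d → Vec d)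
    (L Lbar : ℝ) : Prop where
  lipschitz : ∀ m u v, ‖localOp F m u - localOp F m v‖ ≤ L * ‖u - v‖
  average_lipschitz : ∀ m u v,
    (n : ℝ)⁻¹ * ∑ i, ‖F m i u - F m i v‖ ^ 2 ≤ Lbar ^ 2 * ‖u - v‖ ^ 2

/-- Every `F_m` is `μ`-strongly monotone. -/
def StronglyMonotone {M n d : ℕ} (F : Fin M → Fin n → Vec d → Vec d) (μ : ℝ) : Prop :=
  ∀ m u v, μ * ‖u - v‖ ^ 2 ≤ inner ℝ (localOp F m u - localOp F m v) (u - v)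

/-! ### The network -/

/-- The set of eigenvalues of a real square matrix. -/
def eigenvalueSet {M : ℕ} (W : Matrix (Fin M) (Fin M) ℝ) : Set ℝ :=
  {l | Module.End.HasEigenvalue (Matrix.toLin' W) l}

/-- The largest eigenvalue. -/
def lambdaMax {M : ℕ} (W : Matrix (Fin M) (Fin M) ℝ) : ℝ := sSup (eigenvalueSet W)

/-- The smallest positive eigenvalue. -/
def lambdaMinPos {M : ℕ} (W : Matrix (Fin M) (Fin M) ℝ) : ℝ :=
  sInf {l | l ∈ eigenvalueSet W ∧ 0 < l}

/-- The characteristic number `χ`. -/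
def charNumber {M : ℕ} (W : Matrix (Fin M) (Fin M) ℝ) : ℝ := lambdaMax W / lambdaMinPos W

/-- `W` is a gossip matrix of the network `G`, normalised by `λ_max(W) = 1`. -/
structure IsGossipMatrix {M : ℕ} (G : SimpleGraph (Fin M)) (W : Matrix (Fin M) (Fin M) ℝ) :
    Prop where
  posSemidef : W.PosSemidef
  ker_eq : ∀ x : Fin M → ℝ, W.mulVec x = 0 ↔ ∀ i j, x i = x j
  support : ∀ i j, W i j ≠ 0 ↔ (i = j ∨ G.Adj i j)
  lambdaMax_eq : lambdaMax W = 1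

/-- The action of `W ⊗ I_d` on `(ℝ^d)^M`. -/
def gossip {M d : ℕ} (W : Matrix (Fin M) (Fin M) ℝ) (z : Stack M d) : Stack M d :=
  WithLp.toLp 2 (fun i => ∑ j, W i j • z j)

/-! ### The algorithm -/

/-- The lifted operator `(F_1(z_1), ..., F_M(z_M))`. -/
def liftedOp {M n d : ℕ} (F : Fin M → Fin n → Vec d → Vec d) (z : Stack M d) : Stack M d :=
  WithLp.toLp 2 (fun m => localOp F m (z m))

/-- The lifted regulariser `(1/M) ∑ m, g(z_m)`. -/
def liftedReg {M d : ℕ} (g : Vec d → EReal) (z : Stack M d) : EReal :=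
  (((M : ℝ)⁻¹ : ℝ) : EReal) * ∑ m, g (z m)

/-- The sampled operator `(F_{1,j_1}(z_1), ..., F_{M,j_M}(z_M))`. -/
def sampledOp {M n d : ℕ} (F : Fin M → Fin n → Vec d → Vec d) (j : Fin M → Fin n)
    (z : Stack M d) : Stack M d :=
  WithLp.toLp 2 (fun m => F m (j m) (z m))

/-- `u = prox_{ρ h}(x)`, i.e. `u` minimises `v ↦ ρ h(v) + ‖v - x‖² / 2`. -/
def IsProx {M d : ℕ} (ρ : ℝ) (h : Stack M d → EReal) (x u : Stack M d) : Prop :=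
  ∀ v : Stack M d,
    (ρ : EReal) * h u + ((1 / 2 * ‖u - x‖ ^ 2 : ℝ) : EReal) ≤
      (ρ : EReal) * h v + ((1 / 2 * ‖v - x‖ ^ 2 : ℝ) : EReal)

/-- Stepsizes `η, θ` and momentums `α, β, γ`. -/
structure Params where
  η : ℝ
  θ : ℝ
  α : ℝ
  β : ℝ
  γ : ℝ

/-- The tuning of the parameters. -/
structure Params.IsTuned (q : Params) (μ L Lbar χ p : ℝ) (b : ℕ) : Prop where
  gamma_eq : q.γ = p
  eta_eq : q.η = min (√(q.γ * b) / (4 * Lbar)) (1 / (16 * L * √χ))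
  beta_eq : q.β = min (μ / (4 * L ^ 2)) (b * q.γ / (4 * q.η * Lbar ^ 2))
  theta_eq : q.θ = min (1 / (2 * q.β)) (1 / (16 * q.η))
  alpha_eq : q.α = max (max (1 - μ * q.η / 4) (1 - q.β * q.θ * χ⁻¹))
    (1 - p * q.η * μ / (2 * q.γ + q.η * μ))

/-- The randomness of the algorithm: for every iteration `k`, worker `m` and position `l` in the
batch, the indices `J k m l` (batch `S^k`) and `J' k m l` (batch `S^{k+1/2}`) are uniform, the
coin `ξ k` shows `true` with probability `p`, and all of these are mutually independent. -/
structure IsSampling {Ω : Type*} [MeasurableSpace Ω] (P : Measure Ω) {M n b : ℕ} (p : ℝ)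
    (J J' : ℕ → Fin M → Fin b → Ω → Fin n) (ξ : ℕ → Ω → Bool) : Prop where
  measurable_J : ∀ k m l, Measurable (J k m l)
  measurable_J' : ∀ k m l, Measurable (J' k m l)
  measurable_coin : ∀ k, Measurable (ξ k)
  uniform_J : ∀ k m l i, P {ω | J k m l ω = i} = (n : ENNReal)⁻¹
  uniform_J' : ∀ k m l i, P {ω | J' k m l ω = i} = (n : ENNReal)⁻¹
  coin_prob : ∀ k, P {ω | ξ k ω = true} = ENNReal.ofReal p
  indep : iIndep
    (Sum.elim (fun t : ℕ × Fin M × Fin b => MeasurableSpace.comap (J t.1 t.2.1 t.2.2) ⊤)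
      (Sum.elim (fun t : ℕ × Fin M × Fin b => MeasurableSpace.comap (J' t.1 t.2.1 t.2.2) ⊤)
        (fun k : ℕ => MeasurableSpace.comap (ξ k) ⊤))) P

/-- The estimator
`δ = (1/b) ∑_{j ∈ S} (F_j(z) - F_j(w⁻) + α [F_j(z) - F_j(z⁻)]) + F(w⁻)`,
where `z⁻, w⁻` are the previous iterates. -/
def deltaEst {M n b d : ℕ} (F : Fin M → Fin n → Vec d → Vec d) (α : ℝ)
    (S : Fin M → Fin b → Fin n) (z zPrev wPrev : Stack M d) : Stack M d :=
  (b : ℝ)⁻¹ • ∑ l, ((sampledOp F (fun m => S m l) z - sampledOp F (fun m => S m l) wPrev)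
      + α • (sampledOp F (fun m => S m l) z - sampledOp F (fun m => S m l) zPrev))
    + liftedOp F wPrev

/-- The estimator `Δ^{k+1/2} = (1/b) ∑_{j ∈ S} (F_j(z) - F_j(w)) + F(w)`. -/
def halfEst {M n b d : ℕ} (F : Fin M → Fin n → Vec d → Vec d)
    (S : Fin M → Fin b → Fin n) (z w : Stack M d) : Stack M d :=
  (b : ℝ)⁻¹ • ∑ l, (sampledOp F (fun m => S m l) z - sampledOp F (fun m => S m l) w)
    + liftedOp F w

/-- `z, w, y` are the iterates of the algorithm with the random choices `J, J', ξ`, started at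
`z^0 = w^0` and `y^0`.  The previous iterate has index `k - 1` in `ℕ`; for `k = 0` this is the
index `0`, which encodes `z^{-1} = z^0`, `w^{-1} = w^0`, `y^{-1} = y^0`. -/
structure IsRun {Ω : Type*} {M n b d : ℕ} (F : Fin M → Fin n → Vec d → Vec d)
    (g : Vec d → EReal) (W : Matrix (Fin M) (Fin M) ℝ) (q : Params) (z0 y0 : Stack M d)
    (J J' : ℕ → Fin M → Fin b → Ω → Fin n) (ξ : ℕ → Ω → Bool)
    (z w y : ℕ → Ω → Stack M d) : Prop where
  z_init : ∀ ω, z 0 ω = z0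
  w_init : ∀ ω, w 0 ω = z0
  y_init : ∀ ω, y 0 ω = y0
  z_step : ∀ k ω, IsProx q.η (liftedReg g)
    (z k ω + q.γ • (w k ω - z k ω)
      - q.η • (deltaEst F q.α (fun m l => J k m l ω) (z k ω) (z (k - 1) ω) (w (k - 1) ω)
          - (y k ω + q.α • (y k ω - y (k - 1) ω))))
    (z (k + 1) ω)
  y_step : ∀ k ω, y (k + 1) ω = y k ω - q.θ • gossip W
    (z (k + 1) ω
      - q.β • (halfEst F (fun m l => J' k m l ω) (z (k + 1) ω) (w k ω) - y k ω))
  w_step : ∀ k ω, w (k + 1) ω = if ξ k ω = true then z k ω else w k ω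

end DecentralizedVI

end

open DecentralizedVI

/-! At the solution, the stacked operator splits as F(z*) = (consensus vector with blocks A(z*)/M, A
being the sum of the F_m) + y*, where y* = `dualSolution F zs` is orthogonal to the consensus space.
The first part is balanced by the regulariser through the variational inequality; the second is the
multiplier of the consensus constraint. The algorithm is thus a primal-dual method: a proximal step
in z with momentum, and a gossip step in y, both driven by variance-reduced estimates with reference
point w.

The proof contracts a Lyapunov function, `lyapunov`, by the factor α per iteration in expectation.
It adds up the distances of z and w to z*, the distance of y to y* in the seminorm of the
pseudo-inverse of W ⊗ I, the squares of the last increments, and a cross term from the momentum.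
`primal_descent` and `dual_descent` produce the same coupling term 2η⟨y⁺ - y*, z⁺ - z*⟩ on opposite
sides, so it cancels in their sum. The momentum α returns the cross term multiplied by exactly α.
The estimator noise has mean zero and variance of order `Lbar`²/b times squared distances that the
Lyapunov function contains (`expect_deltaEst`, `expect_halfEst`). The result is
`expect_lyapunov_le`.

Three losses limit α: strong monotonicity (ημ/4), the spectral gap (βθ/χ) and the refresh rate of w.
Under the tuning each is at least 1/64 of the inverse of `complexity` (`one_le_complexity_mul`),
which gives C = 64.

No conditional expectations are needed. The first k draws take finitely many values, all of positive
probability, and the proximal point is unique, so the state is a function of the draws. Expectations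
become finite weighted sums, and the tower property becomes summation over the last draw
(`sum_history_succ`). -/

namespace DecentralizedVI

/-! ### Descent inequalities in an inner product space. -/

section Abstract

variable {E : Type*} [NormedAddCommGroup E] [InnerProductSpace ℝ E]

theorem two_mul_inner_le (c : ℝ) (hc : 0 < c) (x y : E) :
    2 * inner ℝ x y ≤ c * ‖x‖ ^ 2 + c⁻¹ * ‖y‖ ^ 2 := by
  have h1 := real_inner_le_norm x y
  have h2 : c * ‖x‖ ^ 2 + c⁻¹ * ‖y‖ ^ 2 - 2 * (‖x‖ * ‖y‖) = c⁻¹ * (c * ‖x‖ - ‖y‖) ^ 2 := by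
    field_simp
    ring
  have h3 : 0 ≤ c⁻¹ * (c * ‖x‖ - ‖y‖) ^ 2 := by positivity
  linarith

/-- The descent inequality of the primal step. -/
theorem primal_descent {γ η α μ L : ℝ} (hγ1 : γ ≤ 1 / 8) (hη : 0 < η) (hα0 : 0 ≤ α)
    (hα1 : α ≤ 1) (hηL : η * L ≤ 1 / 16)
    {z zm w zp y ym yp zs ys Fz Fzm Fzp Fzs Fb e : E}
    (hprox : inner ℝ (zp - (z + γ • (w - z)
      - η • (Fz + α • (Fz - Fzm) + e - (y + α • (y - ym))))) (zp - zs)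
        ≤ η * inner ℝ Fb (zp - zs))
    (hFzs : Fzs = Fb + ys)
    (hmono : μ * ‖zp - zs‖ ^ 2 ≤ inner ℝ (Fzp - Fzs) (zp - zs))
    (hlip : ‖Fz - Fzm‖ ≤ L * ‖z - zm‖) :
    (1 + 2 * (η * μ)) * ‖zp - zs‖ ^ 2
        - 2 * η * inner ℝ (Fzp - Fz - (yp - y)) (zp - zs)
        + 5 / 16 * ‖zp - z‖ ^ 2 + γ * ‖zp - w‖ ^ 2
      ≤ (1 - γ) * ‖z - zs‖ ^ 2 + γ * ‖w - zs‖ ^ 2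
        - α * (2 * η * inner ℝ (Fz - Fzm - (y - ym)) (z - zs))
        + 2 * η * inner ℝ (yp - ys) (zp - zs)
        - 2 * η * inner ℝ e (z - zs) + 4 * η ^ 2 * ‖e‖ ^ 2
        + 1 / 16 * ‖z - zm‖ ^ 2 + 4 * η ^ 2 * ‖y - ym‖ ^ 2 := by
  obtain ⟨a, rfl⟩ : ∃ a, zp = a + zs := ⟨zp - zs, by abel⟩
  obtain ⟨v, rfl⟩ : ∃ v, z = v + zs := ⟨z - zs, by abel⟩
  obtain ⟨q, rfl⟩ : ∃ q, w = q + zs := ⟨w - zs, by abel⟩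
  obtain ⟨D, rfl⟩ : ∃ D, Fz = D + Fzm := ⟨Fz - Fzm, by abel⟩
  obtain ⟨r, rfl⟩ : ∃ r, y = r + ym := ⟨y - ym, by abel⟩
  -- Momentum and noise are tested at a = v + (a - v). The part along v is kept: it is the old cross
  -- term, respectively a term of mean zero. The part along the increment a - v is absorbed by
  -- squares.
  have e1 : η * inner ℝ (-D) (a - v) ≤ 1 / 32 * (‖v + zs - zm‖ ^ 2 + ‖a - v‖ ^ 2) := by
    have h1 := real_inner_le_norm (-D) (a - v)
    rw [norm_neg] at h1
    have hl : ‖D‖ ≤ L * ‖v + zs - zm‖ := by simpa using hlip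
    have h2 : ‖D‖ * ‖a - v‖ ≤ L * ‖v + zs - zm‖ * ‖a - v‖ := by gcongr
    have h3 : η * inner ℝ (-D) (a - v) ≤ (η * L) * (‖v + zs - zm‖ * ‖a - v‖) := by
      calc _ ≤ η * (L * ‖v + zs - zm‖ * ‖a - v‖) := by gcongr; linarith
        _ = _ := by ring
    have h4 : (η * L) * (‖v + zs - zm‖ * ‖a - v‖) ≤ 1 / 16 * (‖v + zs - zm‖ * ‖a - v‖) := by
      gcongr
    nlinarith [sq_nonneg (‖v + zs - zm‖ - ‖a - v‖)]
  have e1' : α * (2 * η * inner ℝ (-D) (a - v))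
      ≤ 1 / 16 * ‖v + zs - zm‖ ^ 2 + 1 / 16 * ‖a - v‖ ^ 2 := by
    have : 0 ≤ 1 / 16 * ‖v + zs - zm‖ ^ 2 + 1 / 16 * ‖a - v‖ ^ 2 := by positivity
    calc _ ≤ α * (1 / 16 * ‖v + zs - zm‖ ^ 2 + 1 / 16 * ‖a - v‖ ^ 2) := by
            gcongr; linarith
      _ ≤ 1 * _ := by gcongr
      _ = _ := one_mul _
  have e2 : α * (2 * η * inner ℝ r (a - v)) ≤ 4 * η ^ 2 * ‖r‖ ^ 2 + 1 / 4 * ‖a - v‖ ^ 2 := by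
    have h := two_mul_inner_le 4 (by norm_num) (η • r) (a - v)
    rw [norm_smul, inner_smul_left, mul_pow, Real.norm_eq_abs, sq_abs] at h
    simp only [conj_trivial] at h
    have : 0 ≤ 4 * η ^ 2 * ‖r‖ ^ 2 + 1 / 4 * ‖a - v‖ ^ 2 := by positivity
    calc _ ≤ α * (4 * η ^ 2 * ‖r‖ ^ 2 + 1 / 4 * ‖a - v‖ ^ 2) := by
            gcongr; linarith
      _ ≤ 1 * _ := by gcongr
      _ = _ := one_mul _
  have e3 : -(2 * η * inner ℝ e (a - v)) ≤ 4 * η ^ 2 * ‖e‖ ^ 2 + 1 / 4 * ‖a - v‖ ^ 2 := by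
    have h := two_mul_inner_le 4 (by norm_num) (-(η • e)) (a - v)
    rw [norm_neg, norm_smul, inner_neg_left, inner_smul_left, mul_pow, Real.norm_eq_abs,
      sq_abs] at h
    simp only [conj_trivial] at h
    linarith
  -- The proximal step provides (1 - γ)‖a - v‖². The uses are 1/16 + 1/4 + 1/4 above and 5/16 in the
  -- conclusion, 7/8 in all, hence γ ≤ 1/8.
  have e4 : 0 ≤ (1 / 8 - γ) * ‖a - v‖ ^ 2 := by
    have : 0 ≤ 1 / 8 - γ := by linarith
    positivity
  have hm := mul_le_mul_of_nonneg_left hmono (by positivity : 0 ≤ 2 * η)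
  subst hFzs
  simp only [← real_inner_self_eq_norm_sq, add_sub_cancel_right, add_sub_add_right_eq_sub] at *
  simp only [inner_add_left, inner_add_right, inner_sub_left, inner_sub_right, inner_smul_left,
    conj_trivial, inner_neg_left, real_inner_comm a v, real_inner_comm a q] at *
  linarith

/-- The descent inequality of the dual step, in the seminorm `N` with `N (K u) = ⟪u, K u⟫`. -/
theorem dual_descent {η θ β : ℝ} (hη : 0 < η) (hθ : 0 < θ) (hβ : 0 ≤ β) (hβθ : 2 * β * θ ≤ 1)
    (K : E →ₗ[ℝ] E) (hsymm : ∀ x y, inner ℝ (K x) y = inner ℝ x (K y))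
    (hK : ∀ x, ‖K x‖ ^ 2 ≤ inner ℝ x (K x)) (N : E → ℝ)
    (hN : ∀ u, N (K u) = inner ℝ u (K u)) {zp zs y yp ys u h Fzs Fb : E}
    (hu : y - ys = K u) (hyp : yp = y - θ • K (zp - β • (h - y)))
    (hzs : K zs = 0) (hFb : K Fb = 0) (hFzs : Fzs = Fb + ys) :
    η / θ * N (yp - ys) + 2 * η * inner ℝ (yp - ys) (zp - zs) + η / (2 * θ) * ‖yp - y‖ ^ 2
      ≤ η / θ * N (y - ys) - η * β * ‖y - ys‖ ^ 2 + η * β * ‖h - Fzs‖ ^ 2 := by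
  obtain ⟨d, hd⟩ : ∃ d, d = zp - β • (h - y) := ⟨_, rfl⟩
  obtain ⟨g, hg⟩ : ∃ g, g = h - Fzs := ⟨_, rfl⟩
  have hhy : h - y = g + Fb - K u := by rw [hg, hFzs, ← hu]; abel
  have hz : zp = d + β • (g + Fb - K u) := by rw [hd, hhy]; abel
  have h1 : yp - ys = K (u - θ • d) := by
    rw [hyp, ← hd, map_sub, ← hu, map_smul]; abel
  have h2 : yp - y = -(θ • K d) := by rw [hyp, hd]; abel
  have c1 : inner ℝ u (K d) = inner ℝ d (K u) := by rw [← hsymm, real_inner_comm]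
  -- Consensus vectors are invisible to the dual step because the symmetric K kills them.
  have c2 : ∀ x, inner ℝ (K x) zs = 0 := fun x => by rw [hsymm, hzs, inner_zero_right]
  have c3 : ∀ x, inner ℝ (K x) Fb = 0 := fun x => by rw [hsymm, hFb, inner_zero_right]
  have hKd := hK d
  have hsq : 0 ≤ ‖K u - θ • K d - g‖ ^ 2 := by positivity
  rw [← hg, hu, h1, hN, hN, h2, norm_neg]
  have key : inner ℝ (u - θ • d) (K (u - θ • d)) + 2 * θ * inner ℝ (K (u - θ • d)) (zp - zs)
      + 1 / 2 * ‖θ • K d‖ ^ 2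
      ≤ inner ℝ u (K u) - θ * β * ‖K u‖ ^ 2 + θ * β * ‖g‖ ^ 2 := by
    -- `m1` leaves -θ²‖K d‖²/2 after the left-hand square. Expanding `hsq` turns the β terms into
    -- θβ(‖g‖² - ‖K u‖² + θ²‖K d‖²), and 2βθ ≤ 1 (`m3`) pays for the last square.
    have m1 := mul_le_mul_of_nonneg_left hKd (by positivity : 0 ≤ θ ^ 2)
    have m2 := mul_nonneg (by positivity : 0 ≤ θ * β) hsq
    have m3 := mul_nonneg (sub_nonneg.2 hβθ) (by positivity : 0 ≤ θ ^ 2 * ‖K d‖ ^ 2)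
    rw [hz]
    simp only [← real_inner_self_eq_norm_sq] at *
    simp only [map_sub, map_smul, inner_add_right, inner_sub_left, inner_sub_right,
      inner_smul_left, inner_smul_right, conj_trivial, c1, c2, c3,
      real_inner_comm (K u) (K d), real_inner_comm g, real_inner_comm d] at *
    nlinarith
  have hmul := mul_le_mul_of_nonneg_left key (by positivity : 0 ≤ η / θ)
  rw [norm_smul, mul_pow, Real.norm_eq_abs, sq_abs] at *
  have e1 : η / θ * (2 * θ * inner ℝ (K (u - θ • d)) (zp - zs))
      = 2 * η * inner ℝ (K (u - θ • d)) (zp - zs) := by field_simp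
  have e2 : η / θ * (θ * β * ‖K u‖ ^ 2) = η * β * ‖K u‖ ^ 2 := by field_simp
  have e3 : η / θ * (θ * β * ‖g‖ ^ 2) = η * β * ‖g‖ ^ 2 := by field_simp
  have e4 : η / (2 * θ) * (θ ^ 2 * ‖K d‖ ^ 2) = η / θ * (1 / 2 * (θ ^ 2 * ‖K d‖ ^ 2)) := by
    field_simp
  rw [e4, ← e1, ← e2, ← e3]
  linarith

/-- The cross term of the Lyapunov function is dominated by its squares. -/
theorem cross_term_le {η θ L : ℝ} (hη : 0 < η) (hθ : 0 < θ) (hηL : η * L ≤ 1 / 16)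
    (hηθ : 16 * (η * θ) ≤ 1) {z zm y ym zs Fz Fzm : E}
    (hlip : ‖Fz - Fzm‖ ≤ L * ‖z - zm‖) :
    2 * η * inner ℝ (Fz - Fzm - (y - ym)) (z - zs)
      ≤ 1 / 2 * ‖z - zs‖ ^ 2 + 5 / 16 * ‖z - zm‖ ^ 2 + η / (2 * θ) * ‖y - ym‖ ^ 2 := by
  have e1 : 2 * η * inner ℝ (Fz - Fzm) (z - zs) ≤ 1 / 16 * (‖z - zm‖ ^ 2 + ‖z - zs‖ ^ 2) := by
    have h1 := real_inner_le_norm (Fz - Fzm) (z - zs)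
    have h2 : ‖Fz - Fzm‖ * ‖z - zs‖ ≤ L * ‖z - zm‖ * ‖z - zs‖ := by gcongr
    have h3 : η * inner ℝ (Fz - Fzm) (z - zs) ≤ (η * L) * (‖z - zm‖ * ‖z - zs‖) := by
      calc _ ≤ η * (L * ‖z - zm‖ * ‖z - zs‖) := by gcongr; linarith
        _ = _ := by ring
    have h4 : (η * L) * (‖z - zm‖ * ‖z - zs‖) ≤ 1 / 16 * (‖z - zm‖ * ‖z - zs‖) := by
      gcongr
    nlinarith [sq_nonneg (‖z - zm‖ - ‖z - zs‖)]
  have e2 := two_mul_inner_le 4 (by norm_num) (-(η • (y - ym))) (z - zs)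
  rw [norm_neg, norm_smul, inner_neg_left, inner_smul_left, mul_pow, Real.norm_eq_abs,
    sq_abs] at e2
  simp only [conj_trivial] at e2
  have e3 : 4 * η ^ 2 * ‖y - ym‖ ^ 2 ≤ η / (2 * θ) * ‖y - ym‖ ^ 2 := by
    gcongr
    rw [le_div_iff₀ (by positivity)]
    nlinarith
  rw [inner_sub_left]
  nlinarith [sq_nonneg ‖z - zm‖, sq_nonneg ‖z - zs‖]

end Abstract

end DecentralizedVI

/-! ### The proximal step and the variational inequality. -/

namespace DecentralizedVI

variable {M d : ℕ} {g : Vec d → EReal}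

theorem liftedReg_eq_coe (hb : ∀ u, g u ≠ ⊥) {z : Stack M d} (hz : ∀ m, g (z m) ≠ ⊤) :
    liftedReg g z = (((M : ℝ)⁻¹ * ∑ m, (g (z m)).toReal : ℝ) : EReal) := by
  have h : ∑ m, g (z m) = ((∑ m, (g (z m)).toReal : ℝ) : EReal) := by
    have := map_sum (⟨⟨(↑), EReal.coe_zero⟩, EReal.coe_add⟩ : ℝ →+ EReal)
      (fun m => (g (z m)).toReal) Finset.univ
    refine Eq.trans ?_ this.symm
    exact Finset.sum_congr rfl fun m _ => (EReal.coe_toReal (hz m) (hb _)).symm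
  rw [liftedReg, h, EReal.coe_mul]

theorem sum_eq_top_of_eq_top {ι : Type*} {s : Finset ι} {f : ι → EReal} (hb : ∀ i, f i ≠ ⊥)
    {i : ι} (hi : i ∈ s) (h : f i = ⊤) : ∑ i ∈ s, f i = ⊤ := by
  classical
  rw [← Finset.add_sum_erase _ _ hi, h]
  apply EReal.top_add_of_ne_bot
  refine Finset.sum_induction f (· ≠ ⊥) (fun a b ha hb => ?_) (by simp) (fun i _ => hb i)
  simp [EReal.add_eq_bot_iff, ha, hb]

theorem liftedReg_eq_top (hM : 0 < M) (hb : ∀ u, g u ≠ ⊥) {z : Stack M d} {m : Fin M}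
    (hz : g (z m) = ⊤) : liftedReg g z = ⊤ := by
  rw [liftedReg, sum_eq_top_of_eq_top (fun i => hb _) (Finset.mem_univ m) hz]
  exact EReal.coe_mul_top_of_pos (by positivity)

/-- On the domain of a proper convex function, the convexity inequality between real values. -/
theorem ProperLscConvex.convex_toReal (hg : ProperLscConvex g) {u v : Vec d} (hu : g u ≠ ⊤)
    (hv : g v ≠ ⊤) {t : ℝ} (ht0 : 0 ≤ t) (ht1 : t ≤ 1) :
    g (u + t • (v - u)) ≠ ⊤ ∧
      (g (u + t • (v - u))).toReal ≤ (g u).toReal + t * ((g v).toReal - (g u).toReal) := by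
  have h := hg.convex_epigraph
    (x := (u, (g u).toReal)) (by simp [EReal.coe_toReal hu (hg.ne_bot u)])
    (y := (v, (g v).toReal)) (by simp [EReal.coe_toReal hv (hg.ne_bot v)])
    (a := 1 - t) (b := t) (by linarith) ht0 (by ring)
  simp only [Set.mem_ofPred_eq, Prod.smul_mk, Prod.mk_add_mk, smul_eq_mul] at h
  have e1 : (1 - t) • u + t • v = u + t • (v - u) := by module
  have e2 : (1 - t) * (g u).toReal + t * (g v).toReal
      = (g u).toReal + t * ((g v).toReal - (g u).toReal) := by ring
  rw [e1, e2] at h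
  refine ⟨ne_top_of_le_ne_top (EReal.coe_ne_top _) h, ?_⟩
  exact EReal.toReal_le_toReal h (hg.ne_bot _) (EReal.coe_ne_top _)

/-- A proximal point lies in the domain and satisfies the variational characterisation. -/
theorem IsProx.variational (hM : 0 < M) (hg : ProperLscConvex g) {ρ : ℝ} (hρ : 0 < ρ)
    {x u : Stack M d} (h : IsProx ρ (liftedReg g) x u) :
    (∀ m, g (u m) ≠ ⊤) ∧ ∀ v : Stack M d, (∀ m, g (v m) ≠ ⊤) →
      inner ℝ (u - x) (u - v)
        ≤ ρ * ((M : ℝ)⁻¹ * ∑ m, (g (v m)).toReal - (M : ℝ)⁻¹ * ∑ m, (g (u m)).toReal) := by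
  have hdom : ∀ m, g (u m) ≠ ⊤ := by
    intro m hm
    obtain ⟨c, hc⟩ := hg.exists_ne_top
    have h1 := h (diag M c)
    rw [liftedReg_eq_top hM hg.ne_bot hm, liftedReg_eq_coe hg.ne_bot (z := diag M c)
      (fun m => hc), EReal.coe_mul_top_of_pos hρ, EReal.top_add_coe, ← EReal.coe_mul,
      ← EReal.coe_add] at h1
    exact absurd (top_le_iff.1 h1) (EReal.coe_ne_top _)
  refine ⟨hdom, fun v hv => ?_⟩
  set hu' := (M : ℝ)⁻¹ * ∑ m, (g (u m)).toReal with hhu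
  set hv' := (M : ℝ)⁻¹ * ∑ m, (g (v m)).toReal with hhv
  -- Minimality of u is compared with the point u + t(v - u) of the segment and divided by t.
  have key : ∀ t : ℝ, 0 < t → t ≤ 1 →
      inner ℝ (u - x) (u - v) - ρ * (hv' - hu') ≤ t * (1 / 2 * ‖v - u‖ ^ 2) := by
    intro t ht0 ht1
    have hc := fun m => hg.convex_toReal (hdom m) (hv m) ht0.le ht1
    have h1 := h (u + t • (v - u))
    rw [liftedReg_eq_coe hg.ne_bot hdom, liftedReg_eq_coe hg.ne_bot (z := u + t • (v - u))
      (fun m => (hc m).1), ← EReal.coe_mul, ← EReal.coe_mul, ← EReal.coe_add, ← EReal.coe_add,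
      EReal.coe_le_coe_iff] at h1
    have h2 : (M : ℝ)⁻¹ * ∑ m, (g ((u + t • (v - u)) m)).toReal ≤ hu' + t * (hv' - hu') := by
      calc _ ≤ (M : ℝ)⁻¹ * ∑ m, ((g (u m)).toReal + t * ((g (v m)).toReal - (g (u m)).toReal)) := by
            gcongr with m
            exact (hc m).2
        _ = _ := by
            rw [Finset.sum_add_distrib, ← Finset.mul_sum, Finset.sum_sub_distrib]
            ring
    have h3 : ‖u + t • (v - u) - x‖ ^ 2
        = ‖u - x‖ ^ 2 - 2 * t * inner ℝ (u - x) (u - v) + t ^ 2 * ‖v - u‖ ^ 2 := by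
      have : u + t • (v - u) - x = (u - x) - t • (u - v) := by module
      rw [this, norm_sub_sq_real, inner_smul_right, norm_smul, mul_pow, Real.norm_eq_abs, sq_abs,
        norm_sub_rev u v]
      ring
    rw [h3] at h1
    have h4 := mul_le_mul_of_nonneg_left h2 hρ.le
    have h5 : t * (inner ℝ (u - x) (u - v) - ρ * (hv' - hu')) ≤ t * (t * (1 / 2 * ‖v - u‖ ^ 2)) := by
      nlinarith
    exact le_of_mul_le_mul_left h5 ht0
  by_contra hcon
  push Not at hcon
  set A := inner ℝ (u - x) (u - v) - ρ * (hv' - hu') with hA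
  have hApos : 0 < A := by linarith
  set B := 1 / 2 * ‖v - u‖ ^ 2 with hB
  have hB0 : 0 ≤ B := by positivity
  have h1 := key 1 one_pos le_rfl
  have hBpos : 0 < B := by linarith
  -- This replaces the limit t → 0: `h1` says A ≤ B, so t = A/(2B) is admissible, and it yields A ≤
  -- A/2.
  have h2 := key (A / (2 * B)) (by positivity) (by rw [div_le_one (by positivity)]; linarith)
  have h3 : A / (2 * B) * B = A / 2 := by field_simp
  linarith

theorem IsProx.unique (hM : 0 < M) (hg : ProperLscConvex g) {ρ : ℝ} (hρ : 0 < ρ)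
    {x u v : Stack M d} (hu : IsProx ρ (liftedReg g) x u) (hv : IsProx ρ (liftedReg g) x v) :
    u = v := by
  obtain ⟨du, iu⟩ := hu.variational hM hg hρ
  obtain ⟨dv, iv⟩ := hv.variational hM hg hρ
  have h1 := iu v dv
  have h2 := iv u du
  have h3 : inner ℝ (u - x) (u - v) + inner ℝ (v - x) (v - u) = ‖u - v‖ ^ 2 := by
    rw [← neg_sub u v, inner_neg_right, ← sub_eq_add_neg, ← inner_sub_left,
      sub_sub_sub_cancel_right, real_inner_self_eq_norm_sq]
  have h4 : ‖u - v‖ ^ 2 ≤ 0 := by linarith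
  have h5 : ‖u - v‖ = 0 := by nlinarith [norm_nonneg (u - v)]
  exact sub_eq_zero.1 (norm_eq_zero.1 h5)

theorem SolvesVI.ne_top {A : Vec d → Vec d} (hg : ProperLscConvex g) {u : Vec d}
    (h : SolvesVI A g u) : g u ≠ ⊤ := by
  obtain ⟨c, hc⟩ := hg.exists_ne_top
  refine ne_top_of_le_ne_top ?_ (h c)
  rw [← EReal.coe_toReal hc (hg.ne_bot c), ← EReal.coe_add]
  exact EReal.coe_ne_top _

/-- The proximal step from `x`, tested against the solution of the variational inequality. -/
theorem IsProx.inner_le_of_solvesVI (hM : 0 < M) (hg : ProperLscConvex g) {ρ : ℝ} (hρ : 0 < ρ)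
    {x u : Stack M d} (h : IsProx ρ (liftedReg g) x u) {A : Vec d → Vec d} {zs : Vec d}
    (hVI : SolvesVI A g zs) :
    inner ℝ (u - x) (u - diag M zs)
      ≤ ρ * inner ℝ (diag M ((M : ℝ)⁻¹ • A zs)) (u - diag M zs) := by
  obtain ⟨du, iu⟩ := h.variational hM hg hρ
  have hzs := hVI.ne_top hg
  refine (iu (diag M zs) fun m => hzs).trans ?_
  gcongr
  rw [PiLp.inner_apply, ← mul_sub, ← Finset.sum_sub_distrib]
  have : ∀ m, inner ℝ ((diag M ((M : ℝ)⁻¹ • A zs)) m) ((u - diag M zs) m)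
      = (M : ℝ)⁻¹ * inner ℝ (A zs) (u m - zs) := by
    intro m
    simp [diag, inner_smul_left]
  simp only [this, ← Finset.mul_sum]
  gcongr with m
  -- The variational inequality is tested at every block; the weight 1/M is that of `liftedReg`.
  have h1 := hVI (u m)
  rw [← EReal.coe_toReal hzs (hg.ne_bot _), ← EReal.coe_toReal (du m) (hg.ne_bot _),
    ← EReal.coe_add, EReal.coe_le_coe_iff] at h1
  simp only [diag]
  linarith

end DecentralizedVI

/-! ### Spectral bounds for the gossip matrix. -/

namespace DecentralizedVI

variable {M d : ℕ} {W : Matrix (Fin M) (Fin M) ℝ}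

theorem eigenvalueSet_finite (W : Matrix (Fin M) (Fin M) ℝ) : (eigenvalueSet W).Finite :=
  Module.End.finite_hasEigenvalue _

theorem eigenvalues_mem_eigenvalueSet (hW : W.IsHermitian) (i : Fin M) :
    hW.eigenvalues i ∈ eigenvalueSet W := by
  refine Module.End.hasEigenvalue_of_hasEigenvector (x := WithLp.ofLp (hW.eigenvectorBasis i))
    ⟨Module.End.mem_eigenspace_iff.2 ?_, fun h => ?_⟩
  · rw [Matrix.toLin'_apply, hW.mulVec_eigenvectorBasis]
  · have h0 : hW.eigenvectorBasis i = 0 := by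
      ext j
      exact congrFun h j
    have h1 := hW.eigenvectorBasis.orthonormal.1 i
    rw [h0, norm_zero] at h1
    exact zero_ne_one h1

/-- The c i are the coordinates of x in an eigenbasis. They serve both sums, so comparing the two
forms reduces to comparing λ with λ². -/
theorem quadForm_eq_sum_eigenvalues (hW : W.IsHermitian) (x : Fin M → ℝ) :
    ∃ c : Fin M → ℝ, ∑ i, x i * W.mulVec x i = ∑ i, hW.eigenvalues i * c i ^ 2 ∧
      ∑ i, (W.mulVec x i) ^ 2 = ∑ i, hW.eigenvalues i ^ 2 * c i ^ 2 := by
  set B := hW.eigenvectorBasis with hB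
  set X : EuclideanSpace ℝ (Fin M) := WithLp.toLp 2 x with hX
  set Y : EuclideanSpace ℝ (Fin M) := WithLp.toLp 2 (W.mulVec x) with hY
  have key : ∀ i, inner ℝ (B i) Y = hW.eigenvalues i * inner ℝ (B i) X := by
    intro i
    have h1 : W.mulVec (WithLp.ofLp (B i)) = hW.eigenvalues i • WithLp.ofLp (B i) :=
      hW.mulVec_eigenvectorBasis i
    have h2 : Matrix.transpose W = W := by
      rw [← Matrix.conjTranspose_eq_transpose_of_trivial]; exact hW
    calc inner ℝ (B i) Y = WithLp.ofLp (B i) ⬝ᵥ W.mulVec x := by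
          simp [PiLp.inner_apply, dotProduct, hY, mul_comm]
      _ = W.mulVec (WithLp.ofLp (B i)) ⬝ᵥ x := by
          rw [Matrix.dotProduct_mulVec, ← Matrix.mulVec_transpose, h2]
      _ = _ := by
          rw [h1]
          simp [PiLp.inner_apply, dotProduct, hX, mul_comm, Finset.mul_sum, mul_left_comm]
  refine ⟨fun i => inner ℝ (B i) X, ?_, ?_⟩
  · have h1 : ∑ i, x i * W.mulVec x i = inner ℝ X Y := by
      simp [PiLp.inner_apply, hX, hY, mul_comm]
    rw [h1, ← B.sum_inner_mul_inner]
    refine Finset.sum_congr rfl fun i _ => ?_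
    rw [key, real_inner_comm]
    ring
  · have h1 : ∑ i, (W.mulVec x i) ^ 2 = inner ℝ Y Y := by
      rw [PiLp.inner_apply]
      simp [hY, sq]
    rw [h1, ← B.sum_inner_mul_inner]
    refine Finset.sum_congr rfl fun i _ => ?_
    rw [real_inner_comm, key]
    ring

variable {G : SimpleGraph (Fin M)}

theorem IsGossipMatrix.lambdaMinPos_pos (hW : IsGossipMatrix G W) :
    0 < lambdaMinPos W ∧ lambdaMinPos W ≤ 1 := by
  have hfin := eigenvalueSet_finite W
  have hne : (eigenvalueSet W).Nonempty := by
    by_contra h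
    have h1 := hW.lambdaMax_eq
    -- The supremum of the empty set is 0 by convention, which contradicts λ_max = 1.
    rw [lambdaMax, Set.not_nonempty_iff_eq_empty.1 h, Real.sSup_empty] at h1
    exact zero_ne_one h1
  have h1 : (1 : ℝ) ∈ eigenvalueSet W := by
    rw [← hW.lambdaMax_eq]
    exact hne.csSup_mem hfin
  have hfin' : {l | l ∈ eigenvalueSet W ∧ 0 < l}.Finite := hfin.subset fun l hl => hl.1
  have hne' : {l | l ∈ eigenvalueSet W ∧ 0 < l}.Nonempty := ⟨1, h1, one_pos⟩
  exact ⟨(hne'.csInf_mem hfin').2, csInf_le hfin'.bddBelow ⟨h1, one_pos⟩⟩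

theorem IsGossipMatrix.one_le_charNumber (hW : IsGossipMatrix G W) : 1 ≤ charNumber W := by
  obtain ⟨h0, h1⟩ := hW.lambdaMinPos_pos
  rw [charNumber, hW.lambdaMax_eq, le_div_iff₀ h0]
  linarith

/-- Every eigenvalue is 0 or lies in [1/χ, 1], hence λ² ≤ λ ≤ χλ². -/
theorem IsGossipMatrix.quadForm_bounds (hW : IsGossipMatrix G W) (x : Fin M → ℝ) :
    ∑ i, (W.mulVec x i) ^ 2 ≤ ∑ i, x i * W.mulVec x i ∧
      ∑ i, x i * W.mulVec x i ≤ charNumber W * ∑ i, (W.mulVec x i) ^ 2 := by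
  have hH := hW.posSemidef.isHermitian
  obtain ⟨c, h1, h2⟩ := quadForm_eq_sum_eigenvalues hH x
  obtain ⟨hm0, -⟩ := hW.lambdaMinPos_pos
  have hl0 : ∀ i, 0 ≤ hH.eigenvalues i := hW.posSemidef.eigenvalues_nonneg
  have hl1 : ∀ i, hH.eigenvalues i ≤ 1 := fun i => by
    rw [← hW.lambdaMax_eq]
    exact le_csSup (eigenvalueSet_finite W).bddAbove (eigenvalues_mem_eigenvalueSet hH i)
  have hl2 : ∀ i, hH.eigenvalues i ≤ charNumber W * hH.eigenvalues i ^ 2 := fun i => by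
    rcases (hl0 i).eq_or_lt with h | h
    · rw [← h]; simp
    · have h3 : lambdaMinPos W ≤ hH.eigenvalues i :=
        csInf_le ⟨0, fun l hl => hl.2.le⟩ ⟨eigenvalues_mem_eigenvalueSet hH i, h⟩
      rw [charNumber, hW.lambdaMax_eq, one_div, sq, ← mul_assoc]
      refine le_mul_of_one_le_left h.le ?_
      rw [inv_mul_eq_div, le_div_iff₀ hm0]
      linarith
  rw [h1, h2, Finset.mul_sum]
  constructor
  · refine Finset.sum_le_sum fun i _ => mul_le_mul_of_nonneg_right ?_ (sq_nonneg _)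
    nlinarith [hl0 i, hl1 i]
  · refine Finset.sum_le_sum fun i _ => ?_
    rw [← mul_assoc]
    exact mul_le_mul_of_nonneg_right (hl2 i) (sq_nonneg _)

/-- `W ⊗ I_d` as a linear map. -/
def gossipLin (d : ℕ) (W : Matrix (Fin M) (Fin M) ℝ) : Stack M d →ₗ[ℝ] Stack M d where
  toFun := gossip W
  map_add' x y := by
    ext i : 1
    simp [gossip, Finset.sum_add_distrib]
  map_smul' c x := by
    ext i : 1
    simp [gossip, Finset.smul_sum, smul_comm c]

theorem gossip_apply_apply (z : Stack M d) (i : Fin M) (c : Fin d) :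
    gossip W z i c = W.mulVec (fun j => z j c) i := by
  simp [gossip, Matrix.mulVec, dotProduct]

/-- The coordinate of ℝ^d is the outer index because W ⊗ I_d acts on each coordinate separately as
W. -/
theorem inner_eq_sum_sum (x y : Stack M d) :
    inner ℝ x y = ∑ c, ∑ i, x i c * y i c := by
  rw [Finset.sum_comm]
  simp [PiLp.inner_apply, mul_comm]

theorem IsGossipMatrix.gossip_symm (hW : IsGossipMatrix G W) (x y : Stack M d) :
    inner ℝ (gossip W x) y = inner ℝ x (gossip W y) := by
  have h2 : Matrix.transpose W = W := by
    rw [← Matrix.conjTranspose_eq_transpose_of_trivial]; exact hW.posSemidef.isHermitian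
  rw [inner_eq_sum_sum, inner_eq_sum_sum]
  refine Finset.sum_congr rfl fun c _ => ?_
  simp only [gossip_apply_apply]
  have := Matrix.dotProduct_mulVec (fun j => x j c) W (fun j => y j c)
  rw [← Matrix.mulVec_transpose, h2] at this
  exact this.symm

theorem IsGossipMatrix.gossip_bounds (hW : IsGossipMatrix G W) (x : Stack M d) :
    ‖gossip W x‖ ^ 2 ≤ inner ℝ x (gossip W x) ∧
      inner ℝ x (gossip W x) ≤ charNumber W * ‖gossip W x‖ ^ 2 := by
  rw [← real_inner_self_eq_norm_sq, inner_eq_sum_sum, inner_eq_sum_sum, Finset.mul_sum]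
  simp only [gossip_apply_apply, ← sq]
  exact ⟨Finset.sum_le_sum fun c _ => (hW.quadForm_bounds _).1,
    Finset.sum_le_sum fun c _ => (hW.quadForm_bounds _).2⟩

theorem IsGossipMatrix.gossip_eq_zero_iff (hW : IsGossipMatrix G W) (x : Stack M d) :
    gossip W x = 0 ↔ x ∈ consensus M d := by
  have h : gossip W x = 0 ↔ ∀ c, W.mulVec (fun j => x j c) = 0 := by
    constructor
    · intro h c
      ext i
      rw [← gossip_apply_apply, h]
      simp
    · intro h
      ext i c
      rw [gossip_apply_apply, h]
      simp
  rw [h]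
  simp only [hW.ker_eq]
  constructor
  · intro h i j
    ext c
    exact h c i j
  · intro h c i j
    rw [h i j]

/-- For a symmetric map in finite dimension the range is the orthogonal complement of the kernel.
This places y - y* where the dual seminorm is meaningful. -/
theorem IsGossipMatrix.range_gossipLin (hW : IsGossipMatrix G W) :
    (gossipLin d W).range = (consensus M d)ᗮ := by
  have hs : (gossipLin d W).IsSymmetric := fun x y => hW.gossip_symm x y
  have hk : (gossipLin d W).ker = consensus M d := by
    ext x
    exact hW.gossip_eq_zero_iff x
  rw [← hk, ← hs.orthogonal_range, Submodule.orthogonal_orthogonal]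

/-- The squared seminorm of the pseudo-inverse of `W ⊗ I_d`. -/
theorem IsGossipMatrix.exists_dualNorm (hW : IsGossipMatrix G W) :
    ∃ N : Stack M d → ℝ, ∀ u, N (gossip W u) = inner ℝ u (gossip W u) := by
  classical
  refine ⟨fun v => if h : ∃ u, gossip W u = v then inner ℝ h.choose v else 0, fun u => ?_⟩
  have h : ∃ u', gossip W u' = gossip W u := ⟨u, rfl⟩
  simp only [dif_pos h]
  -- Independence of the chosen preimage u' of K u: by symmetry ⟨u', K u⟩ = ⟨K u', u⟩ = ⟨K u, u⟩.
  rw [← hW.gossip_symm, h.choose_spec, real_inner_comm]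

end DecentralizedVI

/-! ### Mean and variance of the batch estimators. -/

noncomputable section

namespace DecentralizedVI

open scoped BigOperators

section Averages

variable {ι κ : Type*} [Fintype ι] [DecidableEq ι] [Fintype κ]
  {V : Type*} [NormedAddCommGroup V] [InnerProductSpace ℝ V]

/-- Summing over the entry a of S first, with the others fixed, already gives 0. The next lemma is
the same computation with the fixed vector replaced by a function of another entry. -/
theorem sum_pi_inner_eq_zero (a : ι) {f : κ → V} (hf : ∑ i, f i = 0) (v : V) :
    ∑ S : ι → κ, inner ℝ (f (S a)) v = 0 := by
  rw [← (Equiv.funSplitAt a κ).symm.sum_comp, Fintype.sum_prod_type_right]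
  refine Finset.sum_eq_zero fun r _ => ?_
  simp [Equiv.funSplitAt, Equiv.piSplitAt, ← sum_inner, hf]

theorem sum_pi_inner_pi_eq_zero {a a' : ι} (h : a' ≠ a) {f : κ → V} (hf : ∑ i, f i = 0)
    (f' : κ → V) : ∑ S : ι → κ, inner ℝ (f (S a)) (f' (S a')) = 0 := by
  rw [← (Equiv.funSplitAt a κ).symm.sum_comp, Fintype.sum_prod_type_right]
  refine Finset.sum_eq_zero fun r _ => ?_
  simp [Equiv.funSplitAt, Equiv.piSplitAt, ← sum_inner, hf, h]

theorem expect_pi_apply [Nonempty κ] (a : ι) (f : κ → ℝ) :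
    𝔼 S : ι → κ, f (S a) = 𝔼 i, f i := by
  have h0 : ∑ i, (f i - 𝔼 j, f j) = 0 := by
    rw [Finset.sum_sub_distrib, Finset.sum_const, Finset.card_univ, Fintype.card_smul_expect,
      sub_self]
  have h1 : ∑ S : ι → κ, (f (S a) - 𝔼 j, f j) = 0 := by
    refine Eq.trans (Finset.sum_congr rfl fun S _ => ?_) (sum_pi_inner_eq_zero (ι := ι) a h0 1)
    simp
  have h2 : 𝔼 S : ι → κ, (f (S a) - 𝔼 j, f j) = 0 := by
    rw [Fintype.expect_eq_sum_div_card]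
    rw [h1, zero_div]
  rw [Finset.expect_sub_distrib, Fintype.expect_const, sub_eq_zero] at h2
  exact h2

end Averages

variable {M n b d : ℕ}

/-- The average of `X` over a batch of indices. -/
def batchMean (X : Fin M → Fin n → Vec d) (S : Fin M × Fin b → Fin n) : Stack M d :=
  WithLp.toLp 2 fun m => (b : ℝ)⁻¹ • ∑ l, X m (S (m, l))

/-- The average of `X` over all indices. -/
def fullMean (X : Fin M → Fin n → Vec d) : Stack M d :=
  WithLp.toLp 2 fun m => (n : ℝ)⁻¹ • ∑ i, X m i

theorem sum_sub_fullMean (hn : 0 < n) (X : Fin M → Fin n → Vec d) (m : Fin M) :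
    ∑ i, (X m i - fullMean X m) = 0 := by
  have : (n : ℝ) ≠ 0 := by positivity
  simp [fullMean, ← Nat.cast_smul_eq_nsmul ℝ, smul_smul, this]

theorem batchMean_sub_fullMean_apply (hb : 0 < b) (X : Fin M → Fin n → Vec d)
    (S : Fin M × Fin b → Fin n) (m : Fin M) :
    (batchMean X S - fullMean X) m = (b : ℝ)⁻¹ • ∑ l, (X m (S (m, l)) - fullMean X m) := by
  have : (b : ℝ) ≠ 0 := by positivity
  simp [batchMean, ← Nat.cast_smul_eq_nsmul ℝ, smul_sub, smul_smul, this]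

theorem expect_inner_batchMean (hb : 0 < b) (hn : 0 < n) (X : Fin M → Fin n → Vec d)
    (v : Stack M d) :
    𝔼 S : Fin M × Fin b → Fin n, inner ℝ (batchMean X S - fullMean X) v = 0 := by
  rw [Fintype.expect_eq_sum_div_card, div_eq_zero_iff]
  left
  have hi : ∀ S : Fin M × Fin b → Fin n, inner ℝ (batchMean X S - fullMean X) v
      = ∑ m, (b : ℝ)⁻¹ * ∑ l, inner ℝ (X m (S (m, l)) - fullMean X m) (v m) := by
    intro S
    rw [PiLp.inner_apply]
    simp only [batchMean_sub_fullMean_apply hb, inner_smul_left, sum_inner, conj_trivial]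
  simp only [hi]
  rw [Finset.sum_comm]
  refine Finset.sum_eq_zero fun m _ => ?_
  rw [← Finset.mul_sum, Finset.sum_comm]
  rw [Finset.sum_eq_zero fun l _ => sum_pi_inner_eq_zero (m, l) (sum_sub_fullMean hn X m) _,
    mul_zero]

theorem sum_sq_sub_fullMean_le (hn : 0 < n) (X : Fin M → Fin n → Vec d) (m : Fin M) :
    ∑ i, ‖X m i - fullMean X m‖ ^ 2 ≤ ∑ i, ‖X m i‖ ^ 2 := by
  have h : ∀ i, ‖X m i‖ ^ 2 = ‖X m i - fullMean X m‖ ^ 2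
      + 2 * inner ℝ (X m i - fullMean X m) (fullMean X m) + ‖fullMean X m‖ ^ 2 := by
    intro i
    rw [← norm_add_sq_real, sub_add_cancel]
  simp only [h, Finset.sum_add_distrib, ← Finset.mul_sum, ← sum_inner, sum_sub_fullMean hn X m,
    inner_zero_left]
  have : 0 ≤ ∑ _i : Fin n, ‖fullMean X m‖ ^ 2 := by positivity
  linarith

/-- For each worker, the cross terms between distinct batch positions vanish, which leaves 1/b times
the variance; the variance is at most the second moment. The workers simply add up in the Euclidean
norm. -/
theorem expect_norm_sq_batchMean (hb : 0 < b) (hn : 0 < n) (X : Fin M → Fin n → Vec d) :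
    𝔼 S : Fin M × Fin b → Fin n, ‖batchMean X S - fullMean X‖ ^ 2
      ≤ (b : ℝ)⁻¹ * ∑ m, (n : ℝ)⁻¹ * ∑ i, ‖X m i‖ ^ 2 := by
  have : Nonempty (Fin n) := ⟨⟨0, hn⟩⟩
  have hb' : (b : ℝ) ≠ 0 := by positivity
  have h1 : ∀ m, 𝔼 S : Fin M × Fin b → Fin n, ‖(batchMean X S - fullMean X) m‖ ^ 2
      = (b : ℝ)⁻¹ * ((n : ℝ)⁻¹ * ∑ i, ‖X m i - fullMean X m‖ ^ 2) := by
    intro m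
    have h2 : ∀ S : Fin M × Fin b → Fin n, ‖(batchMean X S - fullMean X) m‖ ^ 2
        = (b : ℝ)⁻¹ * (b : ℝ)⁻¹ * ∑ l, ∑ l', inner ℝ (X m (S (m, l)) - fullMean X m)
          (X m (S (m, l')) - fullMean X m) := by
      intro S
      rw [batchMean_sub_fullMean_apply hb, ← real_inner_self_eq_norm_sq, inner_smul_left,
        inner_smul_right, sum_inner]
      simp only [inner_sum, conj_trivial]
      ring
    simp only [h2]
    rw [← Finset.mul_expect, Finset.expect_sum_comm]
    have h3 : ∀ l, 𝔼 S : Fin M × Fin b → Fin n, ∑ l', inner ℝ (X m (S (m, l)) - fullMean X m)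
          (X m (S (m, l')) - fullMean X m) = (n : ℝ)⁻¹ * ∑ i, ‖X m i - fullMean X m‖ ^ 2 := by
      intro l
      rw [Finset.expect_sum_comm, Finset.sum_eq_single l]
      · simp only [real_inner_self_eq_norm_sq]
        rw [expect_pi_apply (m, l) fun i => ‖X m i - fullMean X m‖ ^ 2,
          Fintype.expect_eq_sum_div_card, Fintype.card_fin, div_eq_inv_mul]
      · intro l' _ hl
        rw [Fintype.expect_eq_sum_div_card, div_eq_zero_iff]
        left
        exact sum_pi_inner_pi_eq_zero (a := (m, l)) (a' := (m, l'))
          (by simpa using hl) (sum_sub_fullMean hn X m) (fun i => X m i - fullMean X m)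
      · simp
    simp only [h3, Finset.sum_const, Finset.card_univ, Fintype.card_fin, nsmul_eq_mul]
    field_simp
  have hi : ∀ S : Fin M × Fin b → Fin n, ‖batchMean X S - fullMean X‖ ^ 2
      = ∑ m, ‖(batchMean X S - fullMean X) m‖ ^ 2 := fun S => PiLp.norm_sq_eq_of_L2 _ _
  simp only [hi]
  rw [Finset.expect_sum_comm, Finset.mul_sum]
  refine Finset.sum_le_sum fun m _ => ?_
  rw [h1]
  gcongr _ * (_ * ?_)
  exact sum_sq_sub_fullMean_le hn X m

variable {F : Fin M → Fin n → Vec d → Vec d} {L Lbar : ℝ}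

theorem LipschitzAssumption.sum_sampled_le (hF : LipschitzAssumption F L Lbar)
    (z w : Stack M d) :
    ∑ m, (n : ℝ)⁻¹ * ∑ i, ‖F m i (z m) - F m i (w m)‖ ^ 2 ≤ Lbar ^ 2 * ‖z - w‖ ^ 2 := by
  rw [PiLp.norm_sq_eq_of_L2, Finset.mul_sum]
  exact Finset.sum_le_sum fun m _ => hF.average_lipschitz m (z m) (w m)

theorem LipschitzAssumption.liftedOp_lipschitz (hF : LipschitzAssumption F L Lbar) (hL : 0 ≤ L)
    (z w : Stack M d) : ‖liftedOp F z - liftedOp F w‖ ≤ L * ‖z - w‖ := by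
  refine le_of_sq_le_sq ?_ (by positivity)
  rw [mul_pow, PiLp.norm_sq_eq_of_L2, PiLp.norm_sq_eq_of_L2, Finset.mul_sum]
  refine Finset.sum_le_sum fun m _ => ?_
  rw [← mul_pow]
  gcongr
  exact hF.lipschitz m (z m) (w m)

theorem StronglyMonotone.liftedOp {μ : ℝ} (hF : StronglyMonotone F μ) (z w : Stack M d) :
    μ * ‖z - w‖ ^ 2 ≤ inner ℝ (liftedOp F z - liftedOp F w) (z - w) := by
  rw [PiLp.norm_sq_eq_of_L2, PiLp.inner_apply, Finset.mul_sum]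
  exact Finset.sum_le_sum fun m _ => hF m (z m) (w m)

/-- The exact operator plus a centred batch mean: this shows the estimator to be unbiased and
isolates its noise. -/
theorem halfEst_eq (S : Fin M × Fin b → Fin n) (z w : Stack M d) :
    halfEst F (fun m l => S (m, l)) z w = liftedOp F z
      + (batchMean (fun m i => F m i (z m) - F m i (w m)) S
        - fullMean fun m i => F m i (z m) - F m i (w m)) := by
  ext m : 1
  simp [halfEst, batchMean, fullMean, liftedOp, localOp, sampledOp, smul_sub]
  abel

theorem deltaEst_eq (α : ℝ) (S : Fin M × Fin b → Fin n) (z zm wm : Stack M d) :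
    deltaEst F α (fun m l => S (m, l)) z zm wm
      = liftedOp F z + α • (liftedOp F z - liftedOp F zm)
        + (batchMean (fun m i => (F m i (z m) - F m i (wm m))
            + α • (F m i (z m) - F m i (zm m))) S
          - fullMean fun m i => (F m i (z m) - F m i (wm m))
            + α • (F m i (z m) - F m i (zm m))) := by
  ext m : 1
  simp only [deltaEst, batchMean, fullMean, liftedOp, localOp, sampledOp, PiLp.add_apply,
    PiLp.sub_apply, PiLp.smul_apply, WithLp.ofLp_sum, Finset.sum_apply, Finset.sum_add_distrib,
    ← Finset.smul_sum, Finset.sum_sub_distrib, smul_sub, smul_add, smul_comm α]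
  abel

theorem LipschitzAssumption.expect_halfEst (hF : LipschitzAssumption F L Lbar) (hb : 0 < b)
    (hn : 0 < n) (z w v : Stack M d) :
    𝔼 S : Fin M × Fin b → Fin n, ‖halfEst F (fun m l => S (m, l)) z w - v‖ ^ 2
      ≤ ‖liftedOp F z - v‖ ^ 2 + (b : ℝ)⁻¹ * Lbar ^ 2 * ‖z - w‖ ^ 2 := by
  have : Nonempty (Fin n) := ⟨⟨0, hn⟩⟩
  set X : Fin M → Fin n → Vec d := fun m i => F m i (z m) - F m i (w m) with hX
  have h : ∀ S : Fin M × Fin b → Fin n, ‖halfEst F (fun m l => S (m, l)) z w - v‖ ^ 2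
      = ‖batchMean X S - fullMean X‖ ^ 2
        + 2 * inner ℝ (batchMean X S - fullMean X) (liftedOp F z - v)
        + ‖liftedOp F z - v‖ ^ 2 := by
    intro S
    rw [halfEst_eq, ← norm_add_sq_real]
    congr 2
    abel
  simp only [h]
  rw [Finset.expect_add_distrib, Finset.expect_add_distrib, ← Finset.mul_expect,
    expect_inner_batchMean hb hn, Fintype.expect_const]
  have h1 := expect_norm_sq_batchMean hb hn X
  have h2 := mul_le_mul_of_nonneg_left (hF.sum_sampled_le z w) (by positivity : 0 ≤ (b : ℝ)⁻¹)
  linarith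

/-- The noise `e` is a centred batch mean of a sum of two differences; the factor 2 comes from ‖p +
αq‖² ≤ 2‖p‖² + 2‖q‖² for 0 ≤ α ≤ 1. -/
theorem LipschitzAssumption.expect_deltaEst (hF : LipschitzAssumption F L Lbar) (hb : 0 < b)
    (hn : 0 < n) {α : ℝ} (hα0 : 0 ≤ α) (hα1 : α ≤ 1) (z zm wm : Stack M d) :
    ∃ e : (Fin M × Fin b → Fin n) → Stack M d,
      (∀ S, deltaEst F α (fun m l => S (m, l)) z zm wm
        = liftedOp F z + α • (liftedOp F z - liftedOp F zm) + e S) ∧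
      (∀ v, 𝔼 S, inner ℝ (e S) v = 0) ∧
      𝔼 S, ‖e S‖ ^ 2 ≤ (b : ℝ)⁻¹ * (2 * Lbar ^ 2 * (‖z - wm‖ ^ 2 + ‖z - zm‖ ^ 2)) := by
  refine ⟨_, fun S => deltaEst_eq α S z zm wm, expect_inner_batchMean hb hn _,
    (expect_norm_sq_batchMean hb hn _).trans ?_⟩
  gcongr
  have h : ∀ m i, ‖(F m i (z m) - F m i (wm m)) + α • (F m i (z m) - F m i (zm m))‖ ^ 2
      ≤ 2 * ‖F m i (z m) - F m i (wm m)‖ ^ 2 + 2 * ‖F m i (z m) - F m i (zm m)‖ ^ 2 := by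
    intro m i
    set p := F m i (z m) - F m i (wm m)
    set q := F m i (z m) - F m i (zm m)
    have h1 : ‖p + α • q‖ ≤ ‖p‖ + ‖q‖ := by
      refine (norm_add_le _ _).trans ?_
      rw [norm_smul, Real.norm_of_nonneg hα0]
      gcongr
      exact mul_le_of_le_one_left (norm_nonneg _) hα1
    have h2 : ‖p + α • q‖ ^ 2 ≤ (‖p‖ + ‖q‖) ^ 2 := by gcongr
    nlinarith [sq_nonneg (‖p‖ - ‖q‖)]
  calc _ ≤ ∑ m, (n : ℝ)⁻¹ * ∑ i, (2 * ‖F m i (z m) - F m i (wm m)‖ ^ 2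
            + 2 * ‖F m i (z m) - F m i (zm m)‖ ^ 2) := by
        gcongr with m _ i _
        exact h m i
    _ = 2 * ∑ m, (n : ℝ)⁻¹ * ∑ i, ‖F m i (z m) - F m i (wm m)‖ ^ 2
        + 2 * ∑ m, (n : ℝ)⁻¹ * ∑ i, ‖F m i (z m) - F m i (zm m)‖ ^ 2 := by
        simp only [Finset.sum_add_distrib, ← Finset.mul_sum]
        ring
    _ ≤ _ := by linarith [hF.sum_sampled_le z wm, hF.sum_sampled_le z zm]

end DecentralizedVI

end

/-! ### The law of the draws. -/

noncomputable section

namespace DecentralizedVI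

variable {Ω : Type*} [MeasurableSpace Ω] {P : Measure Ω} {M n b : ℕ} {p : ℝ}
  {J J' : ℕ → Fin M → Fin b → Ω → Fin n} {ξ : ℕ → Ω → Bool}

/-- The batches of one iteration for all workers. -/
abbrev Batch (M n b : ℕ) : Type := Fin M × Fin b → Fin n

/-- The two batches and the coin drawn in one iteration. -/
abbrev Draw (M n b : ℕ) : Type := Batch M n b × Batch M n b × Bool

/-- The probability of a draw. -/
def drawWeight (p : ℝ) (v : Draw M n b) : ℝ :=
  (Fintype.card (Batch M n b) : ℝ)⁻¹ * (Fintype.card (Batch M n b) : ℝ)⁻¹ *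
    (if v.2.2 = true then p else 1 - p)

theorem drawWeight_pos (hn : 0 < n) (hp0 : 0 < p) (hp1 : p < 1) (v : Draw M n b) :
    0 < drawWeight p v := by
  have : Nonempty (Fin n) := ⟨⟨0, hn⟩⟩
  have h : 0 < (Fintype.card (Batch M n b) : ℝ) := by exact_mod_cast Fintype.card_pos
  have h2 : 0 < (if v.2.2 = true then p else 1 - p) := by split_ifs <;> linarith
  unfold drawWeight
  positivity

/-- The draw of iteration `k`. -/
def drawAt (J J' : ℕ → Fin M → Fin b → Ω → Fin n) (ξ : ℕ → Ω → Bool) (k : ℕ) (ω : Ω) :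
    Draw M n b :=
  (fun t => J k t.1 t.2 ω, fun t => J' k t.1 t.2 ω, ξ k ω)

/-- The draws of the first `k` iterations. -/
def history (J J' : ℕ → Fin M → Fin b → Ω → Fin n) (ξ : ℕ → Ω → Bool) (k : ℕ) (ω : Ω) :
    Fin k → Draw M n b := fun i => drawAt J J' ξ i ω

theorem IsSampling.measurable_history (h : IsSampling P p J J' ξ) (k : ℕ) :
    Measurable (history J J' ξ k) := by
  refine measurable_pi_lambda _ fun i => ?_
  refine Measurable.prodMk (measurable_pi_lambda _ fun t => h.measurable_J _ _ _) ?_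
  exact Measurable.prodMk (measurable_pi_lambda _ fun t => h.measurable_J' _ _ _)
    (h.measurable_coin _)

theorem IsSampling.prob_coin [IsProbabilityMeasure P] (h : IsSampling P p J J' ξ)
    (hp0 : 0 ≤ p) (k : ℕ) (c : Bool) : P {ω | ξ k ω = c} = ENNReal.ofReal (if c = true then p else 1 - p) := by
  cases c with
  | true => simpa using h.coin_prob k
  | false =>
    have h1 : {ω | ξ k ω = false} = {ω | ξ k ω = true}ᶜ := by
      ext ω
      simp
    have hm : MeasurableSet {ω | ξ k ω = true} :=
      h.measurable_coin k (measurableSet_singleton true)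
    rw [h1, prob_compl_eq_one_sub hm, h.coin_prob]
    rw [← ENNReal.ofReal_one, ← ENNReal.ofReal_sub 1 hp0]
    simp

theorem IsSampling.prob_history [IsProbabilityMeasure P] (h : IsSampling P p J J' ξ)
    (hp0 : 0 ≤ p) (hp1 : p ≤ 1) (k : ℕ) (x : Fin k → Draw M n b) :
    P.real (history J J' ξ k ⁻¹' {x}) = ∏ i, drawWeight p (x i) := by
  set ι := (Fin k × Fin M × Fin b) ⊕ ((Fin k × Fin M × Fin b) ⊕ Fin k)
  -- The injection selects the random variables of the first k iterations, so that independence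
  -- applies to a finite family.
  set gi : ι → (ℕ × Fin M × Fin b) ⊕ ((ℕ × Fin M × Fin b) ⊕ ℕ) :=
    Sum.map (Prod.map (fun i : Fin k => (i : ℕ)) id)
      (Sum.map (Prod.map (fun i : Fin k => (i : ℕ)) id) (fun i : Fin k => (i : ℕ))) with hgi
  have hv : Function.Injective (fun i : Fin k => (i : ℕ)) := Fin.val_injective
  have hinj : Function.Injective gi :=
    Function.Injective.sumMap (hv.prodMap Function.injective_id)
      (Function.Injective.sumMap (hv.prodMap Function.injective_id) hv)
  set s : ι → Set Ω := Sum.elim (fun t => {ω | J t.1 t.2.1 t.2.2 ω = (x t.1).1 t.2})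
    (Sum.elim (fun t => {ω | J' t.1 t.2.1 t.2.2 ω = (x t.1).2.1 t.2})
      (fun i => {ω | ξ i ω = (x i).2.2})) with hs
  have hset : history J J' ξ k ⁻¹' {x} = ⋂ t, s t := by
    ext ω
    simp only [Set.mem_preimage, Set.mem_singleton_iff, Set.mem_iInter]
    constructor
    · rintro rfl (t | t | i) <;> rfl
    · intro hω
      funext i
      refine Prod.ext (funext fun t => hω (Sum.inl (i, t))) (Prod.ext
        (funext fun t => hω (Sum.inr (Sum.inl (i, t)))) (hω (Sum.inr (Sum.inr i))))
  have hind := (h.indep.precomp hinj).meas_iInter (s := s) (by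
    rintro (t | t | i)
    · exact ⟨{(x t.1).1 t.2}, trivial, rfl⟩
    · exact ⟨{(x t.1).2.1 t.2}, trivial, rfl⟩
    · exact ⟨{(x i).2.2}, trivial, rfl⟩)
  rw [hset, measureReal_def, hind, ENNReal.toReal_prod, Fintype.prod_sum_type,
    Fintype.prod_sum_type]
  have e1 : ∀ t, (P (s (Sum.inl t))).toReal = (n : ℝ)⁻¹ := by
    intro t
    have : P (s (Sum.inl t)) = _ := h.uniform_J t.1 t.2.1 t.2.2 ((x t.1).1 t.2)
    rw [this]
    simp
  have e2 : ∀ t, (P (s (Sum.inr (Sum.inl t)))).toReal = (n : ℝ)⁻¹ := by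
    intro t
    have : P (s (Sum.inr (Sum.inl t))) = _ := h.uniform_J' t.1 t.2.1 t.2.2 ((x t.1).2.1 t.2)
    rw [this]
    simp
  have e3 : ∀ i, (P (s (Sum.inr (Sum.inr i)))).toReal
      = if (x i).2.2 = true then p else 1 - p := by
    intro i
    have : P (s (Sum.inr (Sum.inr i))) = _ := h.prob_coin hp0 i ((x i).2.2)
    rw [this, ENNReal.toReal_ofReal]
    split_ifs <;> linarith
  simp only [e1, e2, e3, drawWeight, Finset.prod_mul_distrib, Finset.prod_const,
    Finset.card_univ, Fintype.card_prod, Fintype.card_fin, Fintype.card_fun, Nat.cast_pow,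
    inv_pow, ← pow_mul, mul_comm k]
  ring

/-- Every history occurs, since it has positive probability. -/
theorem IsSampling.history_surjective [IsProbabilityMeasure P] (h : IsSampling P p J J' ξ)
    (hn : 0 < n) (hp0 : 0 < p) (hp1 : p < 1) (k : ℕ) :
    Function.Surjective (history J J' ξ k) := by
  intro x
  have h1 := h.prob_history hp0.le hp1.le k x
  have h2 : 0 < ∏ i, drawWeight p (x i) :=
    Finset.prod_pos fun i _ => drawWeight_pos hn hp0 hp1 _
  rw [← h1] at h2
  have h3 : (history J J' ξ k ⁻¹' {x}).Nonempty := by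
    by_contra hne
    rw [Set.not_nonempty_iff_eq_empty.1 hne] at h2
    simp at h2
  exact h3

theorem IsSampling.integrable_history [IsProbabilityMeasure P] (h : IsSampling P p J J' ξ)
    (k : ℕ) (f : (Fin k → Draw M n b) → ℝ) : Integrable (fun ω => f (history J J' ξ k ω)) P :=
  Integrable.comp_measurable (g := f) (Integrable.of_finite) (h.measurable_history k)

theorem IsSampling.integral_history [IsProbabilityMeasure P] (h : IsSampling P p J J' ξ)
    (hp0 : 0 ≤ p) (hp1 : p ≤ 1) (k : ℕ) (f : (Fin k → Draw M n b) → ℝ) :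
    ∫ ω, f (history J J' ξ k ω) ∂P = ∑ x, (∏ i, drawWeight p (x i)) * f x := by
  have hm := h.measurable_history k
  have : IsProbabilityMeasure (P.map (history J J' ξ k)) :=
    Measure.isProbabilityMeasure_map hm.aemeasurable
  rw [← integral_map (f := f) hm.aemeasurable (Measurable.of_discrete.aestronglyMeasurable),
    integral_fintype Integrable.of_finite]
  refine Finset.sum_congr rfl fun x _ => ?_
  rw [map_measureReal_apply hm (measurableSet_singleton x), h.prob_history hp0 hp1, smul_eq_mul]

/-- Nesting the averages puts the second batch inside the first, as needed when z⁺ depends on S but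
not on S'. -/
theorem sum_drawWeight_mul (p : ℝ) (f : Draw M n b → ℝ) :
    ∑ v, drawWeight p v * f v = Finset.expect Finset.univ fun S : Batch M n b =>
      Finset.expect Finset.univ fun S' : Batch M n b =>
        (p * f (S, S', true) + (1 - p) * f (S, S', false)) := by
  simp only [Fintype.expect_eq_sum_div_card, Fintype.sum_prod_type, Fintype.sum_bool, drawWeight,
    if_true, Bool.false_eq_true, if_false, Finset.sum_div]
  refine Finset.sum_congr rfl fun S _ => Finset.sum_congr rfl fun S' _ => ?_
  ring

theorem sum_history_succ (p : ℝ) (k : ℕ) (f : (Fin (k + 1) → Draw M n b) → ℝ) :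
    ∑ x, (∏ i, drawWeight p (x i)) * f x
      = ∑ x : Fin k → Draw M n b, (∏ i, drawWeight p (x i)) *
          ∑ v, drawWeight p v * f (Fin.snoc x v) := by
  rw [← (Fin.snocEquiv (fun _ : Fin (k + 1) => Draw M n b)).sum_comp,
    Fintype.sum_prod_type_right]
  refine Finset.sum_congr rfl fun x _ => ?_
  rw [Finset.mul_sum]
  refine Finset.sum_congr rfl fun v _ => ?_
  simp only [Fin.snocEquiv, Equiv.coe_fn_mk, Fin.prod_univ_castSucc, Fin.snoc_castSucc,
    Fin.snoc_last]
  ring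

end DecentralizedVI

end

/-! ### The Lyapunov function and its one-step contraction. -/

noncomputable section

namespace DecentralizedVI

open scoped BigOperators

/-- The inequalities between the parameters which the convergence analysis uses. -/
structure Params.Admissible (q : Params) (μ L Lbar χ p b : ℝ) : Prop where
  p_pos : 0 < p
  p_le : p ≤ 1 / 8
  gamma_eq : q.γ = p
  eta_pos : 0 < q.η
  theta_pos : 0 < q.θ
  beta_pos : 0 < q.β
  beta_theta : 2 * q.β * q.θ ≤ 1
  eta_theta : 16 * (q.η * q.θ) ≤ 1
  eta_L : q.η * L ≤ 1 / 16
  eta_Lbar : q.η ^ 2 * (b⁻¹ * Lbar ^ 2) ≤ p / 16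
  beta_L : q.β * L ^ 2 ≤ μ / 4
  beta_Lbar : q.η * q.β * (b⁻¹ * Lbar ^ 2) ≤ p / 4
  eta_mu : q.η * μ ≤ 1 / 16
  alpha_le : q.α ≤ 1
  alpha_eta : 1 - μ * q.η / 4 ≤ q.α
  alpha_chi : 1 - q.β * q.θ * χ⁻¹ ≤ q.α
  alpha_p : 1 - p * q.η * μ / (2 * p + q.η * μ) ≤ q.α

/-- The Lyapunov function without the term of the reference point. -/
def lyapunovCore {M n d : ℕ} (F : Fin M → Fin n → Vec d → Vec d) (N : Stack M d → ℝ) (q : Params)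
    (μ : ℝ) (zs ys z zm wm y ym : Stack M d) : ℝ :=
  (1 + q.η * μ) * ‖z - zs‖ ^ 2 + q.η / q.θ * N (y - ys)
    - 2 * q.η * inner ℝ (liftedOp F z - liftedOp F zm - (y - ym)) (z - zs)
    + 5 / 16 * ‖z - zm‖ ^ 2 + 3 * q.γ / 4 * ‖z - wm‖ ^ 2 + q.η / (2 * q.θ) * ‖y - ym‖ ^ 2

/-- The Lyapunov function. -/
def lyapunov {M n d : ℕ} (F : Fin M → Fin n → Vec d → Vec d) (N : Stack M d → ℝ) (q : Params)
    (μ : ℝ) (zs ys z zm w wm y ym : Stack M d) : ℝ :=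
  lyapunovCore F N q μ zs ys z zm wm y ym
    + (1 + q.η * μ / (2 * q.γ)) * ‖w - zs‖ ^ 2

/-- The optimal dual variable. -/
def dualSolution {M n d : ℕ} (F : Fin M → Fin n → Vec d → Vec d) (u : Vec d) : Stack M d :=
  liftedOp F (diag M u) - diag M ((M : ℝ)⁻¹ • globalOp F u)

variable {M n b d : ℕ} {F : Fin M → Fin n → Vec d → Vec d} {g : Vec d → EReal}
  {G : SimpleGraph (Fin M)} {W : Matrix (Fin M) (Fin M) ℝ} {μ L Lbar p : ℝ} {q : Params}
  {zs : Vec d} {N : Stack M d → ℝ}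

theorem diag_mem_consensus (u : Vec d) : diag M u ∈ consensus M d := fun _ _ => rfl

theorem mem_orthogonal_consensus_iff (v : Stack M d) :
    v ∈ (consensus M d)ᗮ ↔ ∑ m, v m = 0 := by
  have h1 : ∀ u : Vec d, inner ℝ (diag M u) v = inner ℝ u (∑ m, v m) := by
    intro u
    rw [PiLp.inner_apply, inner_sum]
    rfl
  rw [Submodule.mem_orthogonal]
  constructor
  · intro h
    rw [← inner_self_eq_zero (𝕜 := ℝ), ← h1]
    exact h _ (diag_mem_consensus _)
  · intro h u hu
    rcases Nat.eq_zero_or_pos M with rfl | hM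
    · rw [Subsingleton.elim u 0, inner_zero_left]
    · have : u = diag M (u ⟨0, hM⟩) := by
        ext i : 1
        exact hu i _
      rw [this, h1, h, inner_zero_right]

/-- The blocks sum to zero, since the mean of the local operators is subtracted from each of them.
-/
theorem dualSolution_mem (hM : 0 < M) (u : Vec d) :
    dualSolution F u ∈ (consensus M d)ᗮ := by
  have : (M : ℝ) ≠ 0 := by positivity
  rw [mem_orthogonal_consensus_iff]
  simp [dualSolution, liftedOp, diag, globalOp, ← Nat.cast_smul_eq_nsmul ℝ, smul_smul, this]

/-- Only the cross term can be negative. By `cross_term_le` it costs half of ‖z - z*‖² and the two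
increment squares. -/
theorem half_norm_sq_le_lyapunov (hF : LipschitzAssumption F L Lbar) (hL : 0 ≤ L) (hμ : 0 ≤ μ)
    {χ b' : ℝ} (hq : q.Admissible μ L Lbar χ p b') (hW : IsGossipMatrix G W)
    (hN : ∀ u, N (gossip W u) = inner ℝ u (gossip W u)) {ys z zm w wm y ym : Stack M d}
    (hy : y - ys ∈ (gossipLin d W).range) (zs : Stack M d) :
    1 / 2 * ‖z - zs‖ ^ 2 ≤ lyapunov F N q μ zs ys z zm w wm y ym := by
  have h1 := cross_term_le (y := y) (ym := ym) (zs := zs) hq.eta_pos hq.theta_pos hq.eta_L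
    hq.eta_theta (hF.liftedOp_lipschitz hL z zm)
  obtain ⟨u, hu⟩ := hy
  have h2 : 0 ≤ N (y - ys) := by
    rw [← hu]
    have := (hW.gossip_bounds u).1
    have h3 : N (gossipLin d W u) = inner ℝ u (gossip W u) := hN u
    rw [h3]
    exact (sq_nonneg _).trans this
  have hη := hq.eta_pos
  have hθ := hq.theta_pos
  have hγ : 0 < q.γ := hq.gamma_eq ▸ hq.p_pos
  have h4 : 0 ≤ q.η / q.θ * N (y - ys) := by positivity
  have h5 : 0 ≤ q.η * μ * ‖z - zs‖ ^ 2 := by positivity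
  have h6 : 0 ≤ 3 * q.γ / 4 * ‖z - wm‖ ^ 2 := by positivity
  have h7 : 0 ≤ (1 + q.η * μ / (2 * q.γ)) * ‖w - zs‖ ^ 2 := by positivity
  unfold lyapunov lyapunovCore
  linarith

/-- Sum of the primal and dual descents, where the coupling term cancels. The last bracket, a
squared error minus a bound for its mean over the second batch, is paid for by lowering 2ημ to ημ
and γ to 3γ/4. -/
theorem lyapunovCore_step_le (hM : 0 < M) (hg : ProperLscConvex g)
    (hF : LipschitzAssumption F L Lbar) (hL : 0 ≤ L)
    (hmono : StronglyMonotone F μ) (hVI : SolvesVI (globalOp F) g zs)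
    (hW : IsGossipMatrix G W) {χ b' : ℝ} (hq : q.Admissible μ L Lbar χ p b')
    (hN : ∀ u, N (gossip W u) = inner ℝ u (gossip W u)) {z zm w y ym zp e h δ : Stack M d}
    (hy : y - dualSolution F zs ∈ (gossipLin d W).range)
    (hδ : δ = liftedOp F z + q.α • (liftedOp F z - liftedOp F zm) + e)
    (hzp : IsProx q.η (liftedReg g)
      (z + q.γ • (w - z) - q.η • (δ - (y + q.α • (y - ym)))) zp) :
    lyapunovCore F N q μ (diag M zs) (dualSolution F zs) zp z w
        (y - q.θ • gossip W (zp - q.β • (h - y))) y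
      ≤ (1 - q.γ) * ‖z - diag M zs‖ ^ 2 + q.γ * ‖w - diag M zs‖ ^ 2
        - q.α * (2 * q.η * inner ℝ (liftedOp F z - liftedOp F zm - (y - ym)) (z - diag M zs))
        + q.η / q.θ * N (y - dualSolution F zs) - q.η * q.β * ‖y - dualSolution F zs‖ ^ 2
        + 1 / 16 * ‖z - zm‖ ^ 2 + 4 * q.η ^ 2 * ‖y - ym‖ ^ 2
        + (-(2 * q.η * inner ℝ e (z - diag M zs)) + 4 * q.η ^ 2 * ‖e‖ ^ 2)
        + q.η * q.β * (‖h - liftedOp F (diag M zs)‖ ^ 2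
          - (‖liftedOp F zp - liftedOp F (diag M zs)‖ ^ 2 + b'⁻¹ * Lbar ^ 2 * ‖zp - w‖ ^ 2)) := by
  have hη := hq.eta_pos
  have hβ := hq.beta_pos
  have hα0 : 0 ≤ q.α := by linarith [hq.alpha_eta, hq.eta_mu]
  have hFs : liftedOp F (diag M zs) = diag M ((M : ℝ)⁻¹ • globalOp F zs) + dualSolution F zs := by
    rw [dualSolution]; abel
  set yp := y - q.θ • gossip W (zp - q.β • (h - y)) with hyp
  have h1 := primal_descent (yp := yp) (hq.gamma_eq ▸ hq.p_le) hη hα0 hq.alpha_le hq.eta_L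
    (by rw [← hδ]; exact hzp.inner_le_of_solvesVI hM hg hη hVI) hFs
    (hmono.liftedOp zp (diag M zs)) (hF.liftedOp_lipschitz hL z zm)
  obtain ⟨u, hu⟩ := hy
  have h2 := dual_descent hη hq.theta_pos hβ.le hq.beta_theta (gossipLin d W) hW.gossip_symm
    (fun x => (hW.gossip_bounds x).1) N hN (h := h) hu.symm hyp
    ((hW.gossip_eq_zero_iff _).2 (diag_mem_consensus zs))
    ((hW.gossip_eq_zero_iff _).2 (diag_mem_consensus _)) hFs
  have h3 : q.η * q.β * ‖liftedOp F zp - liftedOp F (diag M zs)‖ ^ 2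
      ≤ q.η * μ / 4 * ‖zp - diag M zs‖ ^ 2 := by
    have := hF.liftedOp_lipschitz hL zp (diag M zs)
    have h4 : ‖liftedOp F zp - liftedOp F (diag M zs)‖ ^ 2
      ≤ L ^ 2 * ‖zp - diag M zs‖ ^ 2 := by rw [← mul_pow]; gcongr
    calc _ ≤ q.η * q.β * (L ^ 2 * ‖zp - diag M zs‖ ^ 2) := by gcongr
      _ = q.η * (q.β * L ^ 2) * ‖zp - diag M zs‖ ^ 2 := by ring
      _ ≤ q.η * (μ / 4) * ‖zp - diag M zs‖ ^ 2 := by gcongr; exact hq.beta_L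
      _ = _ := by ring
  have h4 : q.η * q.β * (b'⁻¹ * Lbar ^ 2 * ‖zp - w‖ ^ 2) ≤ q.γ / 4 * ‖zp - w‖ ^ 2 := by
    rw [← mul_assoc, hq.gamma_eq]
    gcongr
    exact hq.beta_Lbar
  -- Together with `h3` this makes ημ‖z⁺ - z*‖² nonnegative.
  have h5 : 0 ≤ q.η * q.β * ‖liftedOp F zp - liftedOp F (diag M zs)‖ ^ 2 := by positivity
  unfold lyapunovCore
  linarith

set_option maxHeartbeats 1000000 in
/-- One iteration contracts the expected Lyapunov function by the factor `α`. -/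
theorem expect_lyapunov_le (hM : 0 < M) (hb : 0 < b) (hn : 0 < n) (hg : ProperLscConvex g)
    (hF : LipschitzAssumption F L Lbar) (hL : 0 ≤ L) (hμ : 0 ≤ μ)
    (hmono : StronglyMonotone F μ) (hVI : SolvesVI (globalOp F) g zs)
    (hW : IsGossipMatrix G W) (hq : q.Admissible μ L Lbar (charNumber W) p b)
    (hN : ∀ u, N (gossip W u) = inner ℝ u (gossip W u)) {z zm w wm y ym : Stack M d}
    (hy : y - dualSolution F zs ∈ (gossipLin d W).range)
    {zp : (Fin M × Fin b → Fin n) → Stack M d}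
    (hzp : ∀ S, IsProx q.η (liftedReg g)
      (z + q.γ • (w - z)
        - q.η • (deltaEst F q.α (fun m l => S (m, l)) z zm wm - (y + q.α • (y - ym)))) (zp S))
    {yp : (Fin M × Fin b → Fin n) → (Fin M × Fin b → Fin n) → Stack M d}
    (hyp : ∀ S S', yp S S' = y - q.θ • gossip W
      (zp S - q.β • (halfEst F (fun m l => S' (m, l)) (zp S) w - y))) :
    𝔼 S, 𝔼 S', (p * lyapunov F N q μ (diag M zs) (dualSolution F zs) (zp S) z z w (yp S S') y
        + (1 - p) * lyapunov F N q μ (diag M zs) (dualSolution F zs) (zp S) z w w (yp S S') y)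
      ≤ q.α * lyapunov F N q μ (diag M zs) (dualSolution F zs) z zm w wm y ym := by
  have : Nonempty (Fin n) := ⟨⟨0, hn⟩⟩
  have hη := hq.eta_pos
  have hβ := hq.beta_pos
  have hθ := hq.theta_pos
  have hp := hq.p_pos
  have hα1 := hq.alpha_le
  have hα0 : 63 / 64 ≤ q.α := by linarith [hq.alpha_eta, hq.eta_mu]
  obtain ⟨e, he1, he2, he3⟩ := hF.expect_deltaEst hb hn (by linarith : 0 ≤ q.α) hα1 z zm wm
  set Z := diag M zs
  set Y := dualSolution F zs
  set c := 1 + q.η * μ / (2 * q.γ) with hc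
  set K := (1 - q.γ) * ‖z - Z‖ ^ 2 + q.γ * ‖w - Z‖ ^ 2
        - q.α * (2 * q.η * inner ℝ (liftedOp F z - liftedOp F zm - (y - ym)) (z - Z))
        + q.η / q.θ * N (y - Y) - q.η * q.β * ‖y - Y‖ ^ 2
        + 1 / 16 * ‖z - zm‖ ^ 2 + 4 * q.η ^ 2 * ‖y - ym‖ ^ 2 with hK
  set Q := c * (p * ‖z - Z‖ ^ 2 + (1 - p) * ‖w - Z‖ ^ 2) with hQ
  have hstep : ∀ S S', p * lyapunov F N q μ Z Y (zp S) z z w (yp S S') y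
        + (1 - p) * lyapunov F N q μ Z Y (zp S) z w w (yp S S') y
      ≤ (K + Q + (-(2 * q.η * inner ℝ (e S) (z - Z)) + 4 * q.η ^ 2 * ‖e S‖ ^ 2))
        + q.η * q.β * (‖halfEst F (fun m l => S' (m, l)) (zp S) w - liftedOp F Z‖ ^ 2
          - (‖liftedOp F (zp S) - liftedOp F Z‖ ^ 2
            + (b : ℝ)⁻¹ * Lbar ^ 2 * ‖zp S - w‖ ^ 2)) := by
    intro S S'
    have := lyapunovCore_step_le hM hg hF hL hmono hVI hW hq hN hy (he1 S) (hzp S)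
      (h := halfEst F (fun m l => S' (m, l)) (zp S) w)
    rw [← hyp] at this
    unfold lyapunov
    linarith
  have hinner : ∀ S, 𝔼 S', (p * lyapunov F N q μ Z Y (zp S) z z w (yp S S') y
        + (1 - p) * lyapunov F N q μ Z Y (zp S) z w w (yp S S') y)
      ≤ K + Q + (-(2 * q.η * inner ℝ (e S) (z - Z)) + 4 * q.η ^ 2 * ‖e S‖ ^ 2) := by
    intro S
    refine (Finset.expect_le_expect fun S' _ => hstep S S').trans ?_
    rw [Finset.expect_add_distrib, Fintype.expect_const, ← Finset.mul_expect,
      Finset.expect_sub_distrib, Fintype.expect_const]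
    have h1 := hF.expect_halfEst hb hn (zp S) w (liftedOp F Z)
    have h2 := mul_nonneg (mul_nonneg hη.le hβ.le) (sub_nonneg.2 h1)
    linarith
  refine (Finset.expect_le_expect fun S _ => hinner S).trans ?_
  rw [Finset.expect_add_distrib, Fintype.expect_const, Finset.expect_add_distrib,
    Finset.expect_neg_distrib, ← Finset.mul_expect, ← Finset.mul_expect, he2]
  have hnoise : 4 * q.η ^ 2 * 𝔼 S, ‖e S‖ ^ 2
      ≤ q.γ / 2 * (‖z - wm‖ ^ 2 + ‖z - zm‖ ^ 2) := by
    calc _ ≤ 4 * q.η ^ 2 * ((b : ℝ)⁻¹ * (2 * Lbar ^ 2 * (‖z - wm‖ ^ 2 + ‖z - zm‖ ^ 2))) := by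
          gcongr
      _ = 8 * (q.η ^ 2 * ((b : ℝ)⁻¹ * Lbar ^ 2)) * (‖z - wm‖ ^ 2 + ‖z - zm‖ ^ 2) := by ring
      _ ≤ 8 * (p / 16) * (‖z - wm‖ ^ 2 + ‖z - zm‖ ^ 2) := by gcongr; exact hq.eta_Lbar
      _ = _ := by rw [hq.gamma_eq]; ring
  -- The spectral gap turns the gain ‖y - y*‖² into at least N(y - y*)/χ, whence the bound 1 - βθ/χ
  -- on α.
  have hdual : q.η / q.θ * N (y - Y) - q.η * q.β * ‖y - Y‖ ^ 2
      ≤ q.α * (q.η / q.θ * N (y - Y)) := by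
    obtain ⟨u, hu⟩ := hy
    have hNu : N (y - Y) = inner ℝ u (gossip W u) := by rw [← hu]; exact hN u
    have hnu : ‖y - Y‖ = ‖gossip W u‖ := by rw [← hu]; rfl
    obtain ⟨hl, hr⟩ := hW.gossip_bounds u
    rw [← hNu, ← hnu] at hl hr
    have hχ := hW.one_le_charNumber
    have hN0 : 0 ≤ N (y - Y) := (sq_nonneg _).trans hl
    have h1 : (charNumber W)⁻¹ * N (y - Y) ≤ ‖y - Y‖ ^ 2 := by
      rw [inv_mul_le_iff₀ (by linarith)]
      exact hr
    have h2 := mul_le_mul_of_nonneg_right hq.alpha_chi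
      (by positivity : 0 ≤ q.η / q.θ * N (y - Y))
    have h3 := mul_le_mul_of_nonneg_left h1 (by positivity : 0 ≤ q.η * q.β)
    have h4 : q.β * q.θ * (charNumber W)⁻¹ * (q.η / q.θ * N (y - Y))
        = q.η * q.β * ((charNumber W)⁻¹ * N (y - Y)) := by field_simp
    linarith
  -- With t = ημ this is 1 + t/2 ≤ (1 - t/4)(1 + t), true for 0 ≤ t ≤ 1. The weight c is chosen so
  -- that cp = p + t/2.
  have hz : ((1 - q.γ) + c * p) * ‖z - Z‖ ^ 2 ≤ q.α * ((1 + q.η * μ) * ‖z - Z‖ ^ 2) := by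
    rw [← mul_assoc]
    gcongr
    have h1 : c * p = p + q.η * μ / 2 := by
      rw [hc, hq.gamma_eq]; field_simp
    have ht : 0 ≤ q.η * μ := by positivity
    have h2 := mul_le_mul_of_nonneg_right hq.alpha_eta (by linarith : 0 ≤ 1 + q.η * μ)
    have h3 := hq.eta_mu
    rw [h1, hq.gamma_eq]
    nlinarith
  -- The left coefficient is c - ημ/2, exactly c times the third lower bound for α.
  have hw : (q.γ + c * (1 - p)) * ‖w - Z‖ ^ 2 ≤ q.α * (c * ‖w - Z‖ ^ 2) := by
    rw [← mul_assoc]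
    gcongr
    have ht : 0 ≤ q.η * μ := by positivity
    have hc0 : 0 ≤ c := by rw [hc, hq.gamma_eq]; positivity
    have h2 := mul_le_mul_of_nonneg_right hq.alpha_p hc0
    have h1 : c * p = p + q.η * μ / 2 := by
      rw [hc, hq.gamma_eq]; field_simp
    have h3 : p * q.η * μ / (2 * p + q.η * μ) * c = q.η * μ / 2 := by
      rw [hc, hq.gamma_eq]; field_simp
    rw [hq.gamma_eq]
    linarith
  have hzm : q.γ / 2 * ‖z - zm‖ ^ 2 + 1 / 16 * ‖z - zm‖ ^ 2 ≤ q.α * (5 / 16 * ‖z - zm‖ ^ 2) := by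
    rw [← add_mul, ← mul_assoc]
    gcongr
    rw [hq.gamma_eq]
    linarith [hq.p_le]
  have hwm : q.γ / 2 * ‖z - wm‖ ^ 2 ≤ q.α * (3 * q.γ / 4 * ‖z - wm‖ ^ 2) := by
    rw [← mul_assoc]
    gcongr
    rw [hq.gamma_eq]
    nlinarith
  have hym : 4 * q.η ^ 2 * ‖y - ym‖ ^ 2 ≤ q.α * (q.η / (2 * q.θ) * ‖y - ym‖ ^ 2) := by
    rw [← mul_assoc]
    refine mul_le_mul_of_nonneg_right ?_ (sq_nonneg _)
    have h1 : 8 * q.η ^ 2 ≤ q.η / (2 * q.θ) := by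
      rw [le_div_iff₀ (by positivity)]
      nlinarith [hq.eta_theta]
    have h2 : 0 ≤ q.η / (2 * q.θ) := by positivity
    nlinarith
  unfold lyapunov lyapunovCore
  linarith

end DecentralizedVI

end

/-! ### The tuning and the resulting complexity. -/

noncomputable section

namespace DecentralizedVI

/-- The complexity of the algorithm up to the logarithmic factor. -/
def complexity (μ L Lbar χ p b : ℝ) : ℝ :=
  1 / p + χ + 1 / √(p * b) * (Lbar / μ) + √χ * (L / μ)

section Tuning

variable {q : Params} {μ L Lbar χ p : ℝ} {b : ℕ}

theorem Params.IsTuned.eta_pos (hq : q.IsTuned μ L Lbar χ p b) (hL : 0 < L) (hLb : 0 < Lbar)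
    (hχ : 1 ≤ χ) (hb : 1 ≤ b) (hp : 0 < p) : 0 < q.η := by
  have hbR : (0 : ℝ) < b := by exact_mod_cast hb
  rw [hq.eta_eq, hq.gamma_eq]
  have : 0 < χ := by linarith
  exact lt_min (by positivity) (by positivity)

theorem Params.IsTuned.admissible (hq : q.IsTuned μ L Lbar χ p b) (hμ : 0 < μ) (hL : 0 < L)
    (hLb : 0 < Lbar) (hμL : μ ≤ L) (hχ : 1 ≤ χ) (hb : 1 ≤ b) (hp : 0 < p) (hp8 : p ≤ 1 / 8) :
    q.Admissible μ L Lbar χ p b := by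
  have hbR : (0 : ℝ) < b := by exact_mod_cast hb
  have hχ0 : 0 < χ := by linarith
  have hη := hq.eta_pos hL hLb hχ hb hp
  have hβ : 0 < q.β := by
    rw [hq.beta_eq, hq.gamma_eq]
    exact lt_min (by positivity) (by positivity)
  have hθ : 0 < q.θ := by
    rw [hq.theta_eq]
    exact lt_min (by positivity) (by positivity)
  have h1 : q.η ≤ √(p * b) / (4 * Lbar) := by
    conv_lhs => rw [hq.eta_eq, hq.gamma_eq]
    exact min_le_left _ _
  have h2 : q.η ≤ 1 / (16 * L * √χ) := by
    conv_lhs => rw [hq.eta_eq]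
    exact min_le_right _ _
  have hsχ : 1 ≤ √χ := Real.one_le_sqrt.2 hχ
  have hηL : q.η * L ≤ 1 / 16 := by
    rw [le_div_iff₀ (by positivity)] at h2
    have : q.η * (16 * L) * 1 ≤ q.η * (16 * L) * √χ := by gcongr
    linarith
  have hγ := hq.gamma_eq
  have hα := hq.alpha_eq
  have hmax : ∀ a b c : ℝ, a ≤ max (max a b) c ∧ b ≤ max (max a b) c ∧ c ≤ max (max a b) c :=
    fun a b c => ⟨(le_max_left _ _).trans (le_max_left _ _),
      (le_max_right _ _).trans (le_max_left _ _), le_max_right _ _⟩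
  refine ⟨hp, hp8, hγ, hη, hθ, hβ, ?_, ?_, hηL, ?_, ?_, ?_, ?_, ?_, ?_, ?_, ?_⟩
  · have : q.θ ≤ 1 / (2 * q.β) := by
      conv_lhs => rw [hq.theta_eq]
      exact min_le_left _ _
    rw [le_div_iff₀ (by positivity)] at this
    linarith
  · have : q.θ ≤ 1 / (16 * q.η) := by
      conv_lhs => rw [hq.theta_eq]
      exact min_le_right _ _
    rw [le_div_iff₀ (by positivity)] at this
    linarith
  · rw [le_div_iff₀ (by positivity)] at h1
    have h3 : (q.η * (4 * Lbar)) ^ 2 ≤ (√(p * b)) ^ 2 := by gcongr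
    rw [Real.sq_sqrt (by positivity)] at h3
    have h4 : q.η ^ 2 * ((b : ℝ)⁻¹ * Lbar ^ 2) = (q.η * (4 * Lbar)) ^ 2 / (16 * b) := by
      field_simp
      ring
    rw [h4, div_le_iff₀ (by positivity)]
    linarith
  · have : q.β ≤ μ / (4 * L ^ 2) := by
      conv_lhs => rw [hq.beta_eq]
      exact min_le_left _ _
    rw [le_div_iff₀ (by positivity)] at this
    linarith
  · have : q.β ≤ b * p / (4 * q.η * Lbar ^ 2) := by
      conv_lhs => rw [hq.beta_eq, hq.gamma_eq]
      exact min_le_right _ _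
    rw [le_div_iff₀ (by positivity)] at this
    have h4 : q.η * q.β * ((b : ℝ)⁻¹ * Lbar ^ 2) = q.β * (4 * q.η * Lbar ^ 2) / (4 * b) := by
      field_simp
    rw [h4, div_le_iff₀ (by positivity)]
    linarith
  -- ημ ≤ ηL ≤ 1/16, by μ ≤ L.
  · nlinarith
  · rw [hα, hγ]
    refine max_le (max_le ?_ ?_) ?_ <;>
    · rw [sub_le_self_iff]
      positivity
  · rw [hα]; exact (hmax _ _ _).1
  · rw [hα]; exact (hmax _ _ _).2.1
  · rw [hα, ← hγ]; exact (hmax _ _ _).2.2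

theorem Params.IsTuned.one_le_complexity_mul (hq : q.IsTuned μ L Lbar χ p b) (hμ : 0 < μ)
    (hL : 0 < L) (hLb : 0 < Lbar) (hμL : μ ≤ L) (hχ : 1 ≤ χ) (hb : 1 ≤ b) (hp : 0 < p)
    (hp8 : p ≤ 1 / 8) : 1 ≤ 64 * complexity μ L Lbar χ p b * (1 - q.α) := by
  have ha := hq.admissible hμ hL hLb hμL hχ hb hp hp8
  have hbR : (0 : ℝ) < b := by exact_mod_cast hb
  have hχ0 : 0 < χ := by linarith
  have hη := ha.eta_pos
  have hβ := ha.beta_pos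
  have hθ := ha.theta_pos
  have hspb : 0 < √(p * b) := by positivity
  have hsχ : 0 < √χ := by positivity
  have hsχ2 : √χ * √χ = χ := Real.mul_self_sqrt hχ0.le
  set B := complexity μ L Lbar χ p b with hB
  have t1 : 0 < 1 / p := by positivity
  have t3 : 0 < 1 / √(p * b) * (Lbar / μ) := by positivity
  have t4 : 0 < √χ * (L / μ) := by positivity
  have b1 : 1 / p ≤ B := by rw [hB, complexity]; linarith
  have b2 : χ ≤ B := by rw [hB, complexity]; linarith
  have b3 : 1 / √(p * b) * (Lbar / μ) ≤ B := by rw [hB, complexity]; linarith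
  have b4 : √χ * (L / μ) ≤ B := by rw [hB, complexity]; linarith
  have hB0 : 0 < B := by linarith
  have hBη : 1 ≤ 16 * B * (μ * q.η) := by
    rcases min_choice (√(q.γ * b) / (4 * Lbar)) (1 / (16 * L * √χ)) with h | h
    · have hη' := hq.eta_eq.trans h
      rw [hq.gamma_eq] at hη'
      calc (1 : ℝ) ≤ 4 := by norm_num
        _ = 16 * (1 / √(p * b) * (Lbar / μ)) * (μ * q.η) := by
            rw [hη']
            field_simp
            norm_num
        _ ≤ _ := by gcongr
    · have hη' := hq.eta_eq.trans h
      calc (1 : ℝ) = 16 * (√χ * (L / μ)) * (μ * q.η) := by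
            rw [hη']
            field_simp
        _ ≤ _ := by gcongr
  -- If θ = 1/(2β), the term χ of B suffices. Otherwise βθ is a constant times μ/(ηL²) or
  -- bp/(η²`Lbar`²), and the upper bounds on η bring in the terms √χ L/μ and χ.
  have hBα : 1 ≤ 64 * B * (q.β * q.θ * χ⁻¹) := by
    rcases min_choice (1 / (2 * q.β)) (1 / (16 * q.η)) with h | h
    · have hθ' := hq.theta_eq.trans h
      calc (1 : ℝ) ≤ 32 := by norm_num
        _ = 64 * χ * (q.β * q.θ * χ⁻¹) := by
            rw [hθ']
            field_simp
            norm_num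
        _ ≤ _ := by gcongr
    · have hθ' := hq.theta_eq.trans h
      rcases min_choice (μ / (4 * L ^ 2)) (b * q.γ / (4 * q.η * Lbar ^ 2)) with h' | h'
      · have hβ' := hq.beta_eq.trans h'
        have h2 : q.η * (16 * L * √χ) ≤ 1 := by
          have : q.η ≤ 1 / (16 * L * √χ) := by
            conv_lhs => rw [hq.eta_eq]
            exact min_le_right _ _
          rwa [le_div_iff₀ (by positivity)] at this
        calc (1 : ℝ) ≤ 64 * (√χ * (L / μ)) * (q.β * q.θ * χ⁻¹) := by
              have : 64 * (√χ * (L / μ)) * (q.β * q.θ * χ⁻¹) = 1 / (q.η * (L * √χ)) := by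
                rw [hθ', hβ']
                field_simp
                rw [Real.sq_sqrt hχ0.le]
                norm_num
              rw [this, le_div_iff₀ (by positivity)]
              have : 0 < q.η * (L * √χ) := by positivity
              linarith
          _ ≤ _ := by gcongr
      · have hβ' := hq.beta_eq.trans h'
        rw [hq.gamma_eq] at hβ'
        calc (1 : ℝ) ≤ 64 * χ * (q.β * q.θ * χ⁻¹) := by
              have : 64 * χ * (q.β * q.θ * χ⁻¹)
                  = p / (q.η ^ 2 * ((b : ℝ)⁻¹ * Lbar ^ 2)) := by
                rw [hθ', hβ']
                field_simp
                norm_num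
              rw [this, le_div_iff₀ (by positivity)]
              linarith [ha.eta_Lbar]
          _ ≤ _ := by gcongr
  have hBp : 1 ≤ 64 * B * (p * q.η * μ / (2 * p + q.η * μ)) := by
    have ht : 0 < μ * q.η := by positivity
    rw [← mul_div_assoc, le_div_iff₀ (by positivity)]
    have h1 : 1 ≤ B * p := by rwa [div_le_iff₀ hp] at b1
    have h2 := mul_le_mul_of_nonneg_right hBη hp.le
    have h3 := mul_le_mul_of_nonneg_right h1 ht.le
    -- With t = ημ, `h2` and `h3` give 2p + t ≤ 33Bpt.
    nlinarith
  have key : q.α ≤ 1 - 1 / (64 * B) := by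
    have h64 : ∀ x : ℝ, 1 ≤ 64 * B * x → 1 - x ≤ 1 - 1 / (64 * B) := by
      intro x hx
      have : 1 / (64 * B) ≤ x := by
        rw [div_le_iff₀ (by positivity)]
        linarith
      linarith
    rw [hq.alpha_eq, hq.gamma_eq]
    exact max_le (max_le (h64 _ (by linarith)) (h64 _ hBα)) (h64 _ hBp)
  have : 1 / (64 * B) ≤ 1 - q.α := by linarith
  rwa [div_le_iff₀ (by positivity), mul_comm] at this

end Tuning

theorem mul_pow_le_of_log_le {α B R ε : ℝ} {k : ℕ} (hα0 : 0 ≤ α) (hα1 : α ≤ 1)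
    (hB : 1 ≤ B * (1 - α)) (hR : 0 < R) (hε : 0 < ε) (hk : B * Real.log (R / ε) ≤ k) :
    R * α ^ k ≤ ε := by
  rcases le_or_gt (Real.log (R / ε)) 0 with h | h
  -- The lower bound on k is void here, but R ≤ ε already.
  · have h1 : R / ε ≤ 1 := (Real.log_nonpos_iff (by positivity)).1 h
    rw [div_le_one hε] at h1
    exact (mul_le_of_le_one_right hR.le (pow_le_one₀ hα0 hα1)).trans h1
  · have h1 : α ^ k ≤ Real.exp (-((1 - α) * k)) := by
      calc α ^ k ≤ Real.exp (-(1 - α)) ^ k := by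
            gcongr
            linarith [Real.add_one_le_exp (-(1 - α))]
        _ = _ := by rw [← Real.exp_nat_mul]; congr 1; ring
    have h2 : Real.log (R / ε) ≤ (1 - α) * k := by
      have := mul_le_mul_of_nonneg_left hk (by linarith : 0 ≤ 1 - α)
      have h3 := mul_le_mul_of_nonneg_right hB h.le
      linarith
    calc R * α ^ k ≤ R * Real.exp (-Real.log (R / ε)) := by
          gcongr
          exact h1.trans (Real.exp_le_exp.2 (by linarith))
      _ = ε := by
          rw [Real.exp_neg, Real.exp_log (by positivity)]
          field_simp

end DecentralizedVI

end

/-! ### Runs of the algorithm in expectation. -/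

noncomputable section

namespace DecentralizedVI

section Run

variable {Ω : Type*} {M n b d : ℕ} {F : Fin M → Fin n → Vec d → Vec d} {g : Vec d → EReal}
  {G : SimpleGraph (Fin M)} {W : Matrix (Fin M) (Fin M) ℝ} {q : Params} {z0 y0 : Stack M d}
  {J J' : ℕ → Fin M → Fin b → Ω → Fin n} {ξ : ℕ → Ω → Bool} {z w y : ℕ → Ω → Stack M d}

/-- The primal iterate is determined by the current state and by the first batch. -/
theorem IsRun.z_succ_congr (h : IsRun F g W q z0 y0 J J' ξ z w y) (hM : 0 < M)
    (hg : ProperLscConvex g) (hη : 0 < q.η) {k : ℕ} {ω ω' : Ω}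
    (hJ : (drawAt J J' ξ k ω).1 = (drawAt J J' ξ k ω').1) (hz : z k ω = z k ω')
    (hz' : z (k - 1) ω = z (k - 1) ω') (hw : w k ω = w k ω') (hw' : w (k - 1) ω = w (k - 1) ω')
    (hy : y k ω = y k ω') (hy' : y (k - 1) ω = y (k - 1) ω') : z (k + 1) ω = z (k + 1) ω' := by
  have h1 := h.z_step k ω
  have e : (fun m l => J k m l ω) = fun m l => J k m l ω' := by
    funext m l
    exact congrFun hJ (m, l)
  rw [e, hz, hz', hw, hw', hy, hy'] at h1
  exact h1.unique hM hg hη (h.z_step k ω')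

/-- The state after `k` iterations is determined by the first `k` draws. -/
theorem IsRun.state_congr (h : IsRun F g W q z0 y0 J J' ξ z w y) (hM : 0 < M)
    (hg : ProperLscConvex g) (hη : 0 < q.η) {ω ω' : Ω} (k : ℕ)
    (hd : ∀ i < k, drawAt J J' ξ i ω = drawAt J J' ξ i ω') :
    z k ω = z k ω' ∧ w k ω = w k ω' ∧ y k ω = y k ω' := by
  induction k using Nat.strong_induction_on with
  | _ k ih =>
    cases k with
    | zero => simp [h.z_init, h.w_init, h.y_init]
    | succ k =>
      obtain ⟨a1, a2, a3⟩ := ih k (by omega) fun i hi => hd i (by omega)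
      -- The momentum needs the previous state too, hence strong induction; for k = 0 truncated
      -- subtraction gives the initial state again.
      obtain ⟨c1, c2, c3⟩ := ih (k - 1) (by omega) fun i hi => hd i (by omega)
      have hk := hd k (by omega)
      have hz := h.z_succ_congr hM hg hη (congrArg Prod.fst hk) a1 c1 a2 c2 a3 c3
      have e : (fun m l => J' k m l ω) = fun m l => J' k m l ω' := by
        funext m l
        exact congrFun (congrArg (fun v => v.2.1) hk) (m, l)
      have eξ : ξ k ω = ξ k ω' := congrArg (fun v => v.2.2) hk
      refine ⟨hz, ?_, ?_⟩
      · rw [h.w_step, h.w_step, eξ, a1, a2]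
      · rw [h.y_step, h.y_step, e, hz, a2, a3]

theorem IsRun.y_sub_mem_range (h : IsRun F g W q z0 y0 J J' ξ z w y) {Y : Stack M d}
    (h0 : y0 - Y ∈ (gossipLin d W).range) (k : ℕ) (ω : Ω) :
    y k ω - Y ∈ (gossipLin d W).range := by
  induction k with
  | zero => rwa [h.y_init]
  | succ k ih =>
    rw [h.y_step, sub_right_comm]
    exact Submodule.sub_mem _ ih (Submodule.smul_mem _ _ ⟨_, rfl⟩)

/-- The Lyapunov function along a run. -/
def runLyapunov (F : Fin M → Fin n → Vec d → Vec d) (N : Stack M d → ℝ) (q : Params) (μ : ℝ)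
    (zs ys : Stack M d) (z w y : ℕ → Ω → Stack M d) (k : ℕ) (ω : Ω) : ℝ :=
  lyapunov F N q μ zs ys (z k ω) (z (k - 1) ω) (w k ω) (w (k - 1) ω) (y k ω) (y (k - 1) ω)

variable {N : Stack M d → ℝ} {μ L Lbar p : ℝ} {zs : Vec d} [MeasurableSpace Ω] {P : Measure Ω}
  [IsProbabilityMeasure P]

theorem IsRun.expected_lyapunov_le (h : IsRun F g W q z0 y0 J J' ξ z w y)
    (hS : IsSampling P p J J' ξ) (hM : 0 < M) (hb : 0 < b) (hn : 0 < n)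
    (hg : ProperLscConvex g) (hF : LipschitzAssumption F L Lbar) (hL : 0 ≤ L) (hμ : 0 ≤ μ)
    (hmono : StronglyMonotone F μ) (hVI : SolvesVI (globalOp F) g zs)
    (hW : IsGossipMatrix G W) (hq : q.Admissible μ L Lbar (charNumber W) p b)
    (hN : ∀ u, N (gossip W u) = inner ℝ u (gossip W u))
    (hy0 : y0 - dualSolution F zs ∈ (gossipLin d W).range) (k : ℕ) :
    Integrable (runLyapunov F N q μ (diag M zs) (dualSolution F zs) z w y k) P ∧
      ∫ ω, runLyapunov F N q μ (diag M zs) (dualSolution F zs) z w y k ω ∂P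
        ≤ q.α ^ k * lyapunov F N q μ (diag M zs) (dualSolution F zs) z0 z0 z0 z0 y0 y0 := by
  have hη := hq.eta_pos
  have hp0 := hq.p_pos
  have hp1 : p < 1 := by linarith [hq.p_le]
  have hα0 : 0 ≤ q.α := by linarith [hq.alpha_eta, hq.eta_mu]
  -- One sample point is picked for each history, so that every iterate becomes a function on a
  -- finite set.
  choose ρ hρ using fun k => hS.history_surjective hn hp0 hp1 k
  set Z := diag M zs
  set Y := dualSolution F zs
  set Ψ := runLyapunov F N q μ Z Y z w y with hΨ
  have hd : ∀ k x, ∀ i (hi : i < k), drawAt J J' ξ i (ρ k x) = x ⟨i, hi⟩ := fun k x i hi =>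
    congrFun (hρ k x) ⟨i, hi⟩
  have hcongr : ∀ k, Ψ k = fun ω => Ψ k (ρ k (history J J' ξ k ω)) := by
    intro k
    funext ω
    have hdr : ∀ i < k, drawAt J J' ξ i ω
        = drawAt J J' ξ i (ρ k (history J J' ξ k ω)) := fun i hi =>
      (congrFun (hρ k (history J J' ξ k ω)) ⟨i, hi⟩).symm
    obtain ⟨a1, a2, a3⟩ := h.state_congr hM hg hη k hdr
    obtain ⟨c1, c2, c3⟩ := h.state_congr hM hg hη (k - 1) fun i hi => hdr i (by omega)
    simp only [hΨ, runLyapunov, a1, a2, a3, c1, c2, c3]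
  refine ⟨by rw [hcongr k]; exact hS.integrable_history k fun x => Ψ k (ρ k x), ?_⟩
  have hint : ∀ k, ∫ ω, Ψ k ω ∂P = ∑ x, (∏ i, drawWeight p (x i)) * Ψ k (ρ k x) := by
    intro k
    exact (congrArg (fun f => ∫ ω, f ω ∂P) (hcongr k)).trans
      (hS.integral_history hp0.le hp1.le k fun x => Ψ k (ρ k x))
  induction k with
  | zero => simp [hΨ, runLyapunov, h.z_init, h.w_init, h.y_init]
  | succ k ih =>
    have hstep : ∫ ω, Ψ (k + 1) ω ∂P ≤ q.α * ∫ ω, Ψ k ω ∂P := by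
      rw [hint, hint, sum_history_succ, Finset.mul_sum]
      refine Finset.sum_le_sum fun x _ => ?_
      rw [mul_left_comm]
      refine mul_le_mul_of_nonneg_left ?_
        (Finset.prod_nonneg fun i _ => (drawWeight_pos hn hp0 hp1 _).le)
      rw [sum_drawWeight_mul]
      set ω := ρ k x with hω
      have hpast : ∀ v, ∀ i < k, drawAt J J' ξ i (ρ (k + 1) (Fin.snoc x v))
          = drawAt J J' ξ i ω := by
        intro v i hi
        rw [hω, hd k x i hi, hd (k + 1) _ i (by omega)]
        exact Fin.snoc_castSucc (α := fun _ => Draw M n b) v x ⟨i, hi⟩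
      have hlast : ∀ v, drawAt J J' ξ k (ρ (k + 1) (Fin.snoc x v)) = v := by
        intro v
        rw [hd (k + 1) _ k (by omega)]
        exact Fin.snoc_last (α := fun _ => Draw M n b) v x
      have hs1 := fun v => h.state_congr hM hg hη k (hpast v)
      have hs2 := fun v => h.state_congr hM hg hη (k - 1) fun i hi => hpast v i (by omega)
      have hJ : ∀ v, (fun m l => J k m l (ρ (k + 1) (Fin.snoc x v))) = fun m l => v.1 (m, l) := by
        intro v
        funext m l
        exact congrFun (congrArg Prod.fst (hlast v)) (m, l)
      have hJ' : ∀ v, (fun m l => J' k m l (ρ (k + 1) (Fin.snoc x v)))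
          = fun m l => v.2.1 (m, l) := by
        intro v
        funext m l
        exact congrFun (congrArg (fun v => v.2.1) (hlast v)) (m, l)
      have hξ : ∀ v, ξ k (ρ (k + 1) (Fin.snoc x v)) = v.2.2 := fun v =>
        congrArg (fun v => v.2.2) (hlast v)
      -- The second batch S and the coin `true` are placeholders: `hz` shows that the new primal
      -- iterate depends on the first batch alone.
      set zp : Batch M n b → Stack M d :=
        fun S => z (k + 1) (ρ (k + 1) (Fin.snoc x (S, S, true))) with hzp
      set yp : Batch M n b → Batch M n b → Stack M d := fun S S' => y k ω - q.θ • gossip W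
        (zp S - q.β • (halfEst F (fun m l => S' (m, l)) (zp S) (w k ω) - y k ω)) with hyp
      have hz : ∀ v, z (k + 1) (ρ (k + 1) (Fin.snoc x v)) = zp v.1 := by
        intro v
        refine h.z_succ_congr hM hg hη (by rw [hlast, hlast]) ?_ ?_ ?_ ?_ ?_ ?_
        · rw [(hs1 _).1, (hs1 _).1]
        · rw [(hs2 _).1, (hs2 _).1]
        · rw [(hs1 _).2.1, (hs1 _).2.1]
        · rw [(hs2 _).2.1, (hs2 _).2.1]
        · rw [(hs1 _).2.2, (hs1 _).2.2]
        · rw [(hs2 _).2.2, (hs2 _).2.2]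
      have hy : ∀ v, y (k + 1) (ρ (k + 1) (Fin.snoc x v)) = yp v.1 v.2.1 := by
        intro v
        rw [h.y_step, hJ', hz, (hs1 _).2.1, (hs1 _).2.2]
      have hmain := expect_lyapunov_le (N := N) (yp := yp) hM hb hn hg hF hL hμ hmono hVI hW hq
        hN (z := z k ω) (zm := z (k - 1) ω) (w := w k ω) (wm := w (k - 1) ω) (y := y k ω)
        (ym := y (k - 1) ω) (h.y_sub_mem_range hy0 k ω) (zp := zp)
        (fun S => by
          have := h.z_step k (ρ (k + 1) (Fin.snoc x (S, S, true)))
          rwa [hJ, (hs1 _).1, (hs1 _).2.1, (hs1 _).2.2, (hs2 _).1, (hs2 _).2.1,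
            (hs2 _).2.2] at this)
        (fun S S' => rfl)
      have hval : ∀ v, Ψ (k + 1) (ρ (k + 1) (Fin.snoc x v)) = lyapunov F N q μ Z Y (zp v.1)
          (z k ω) (if v.2.2 = true then z k ω else w k ω) (w k ω) (yp v.1 v.2.1) (y k ω) := by
        intro v
        simp only [hΨ, runLyapunov, Nat.add_sub_cancel]
        rw [h.w_step, hξ, hz, hy, (hs1 _).1, (hs1 _).2.1, (hs1 _).2.2]
      simp only [hval, if_true, Bool.false_eq_true, if_false]
      exact hmain
    calc _ ≤ q.α * ∫ ω, Ψ k ω ∂P := hstep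
      _ ≤ q.α * (q.α ^ k * lyapunov F N q μ Z Y z0 z0 z0 z0 y0 y0) := by gcongr
      _ = _ := by rw [pow_succ]; ring

theorem IsRun.integrable_norm_sq (h : IsRun F g W q z0 y0 J J' ξ z w y)
    (hS : IsSampling P p J J' ξ) (hM : 0 < M) (hn : 0 < n) (hg : ProperLscConvex g)
    (hη : 0 < q.η) (hp0 : 0 < p) (hp1 : p < 1) (v : Stack M d) (k : ℕ) :
    Integrable (fun ω => ‖z k ω - v‖ ^ 2) P := by
  choose ρ hρ using hS.history_surjective hn hp0 hp1 k
  have hcongr : (fun ω => ‖z k ω - v‖ ^ 2)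
      = fun ω => ‖z k (ρ (history J J' ξ k ω)) - v‖ ^ 2 := by
    funext ω
    rw [(h.state_congr (ω := ω) (ω' := ρ (history J J' ξ k ω)) hM hg hη k fun i hi =>
      (congrFun (hρ (history J J' ξ k ω)) ⟨i, hi⟩).symm).1]
  rw [hcongr]
  exact hS.integrable_history k fun x => ‖z k (ρ x) - v‖ ^ 2

end Run

theorem modulus_le_lipschitz {M n d : ℕ} {F : Fin M → Fin n → Vec d → Vec d} {μ L Lbar : ℝ}
    (hM : 0 < M) (hd : 0 < d) (hF : LipschitzAssumption F L Lbar) (hmono : StronglyMonotone F μ) :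
    μ ≤ L := by
  have h1 := hmono ⟨0, hM⟩ (EuclideanSpace.single ⟨0, hd⟩ (1 : ℝ)) 0
  have h2 := hF.lipschitz ⟨0, hM⟩ (EuclideanSpace.single ⟨0, hd⟩ (1 : ℝ)) 0
  have h3 := h1.trans (real_inner_le_norm _ _)
  have h4 : ‖EuclideanSpace.single (⟨0, hd⟩ : Fin d) (1 : ℝ) - 0‖ = 1 := by simp
  rw [h4] at h2 h3
  linarith

end DecentralizedVI

end

/-! ### The complexity theorem. -/

theorem theorem3 :
    ∃ C : ℝ, 0 < C ∧
      ∀ (d M n b : ℕ) (F : Fin M → Fin n → Vec d → Vec d) (g : Vec d → EReal)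
        (G : SimpleGraph (Fin M)) (W : Matrix (Fin M) (Fin M) ℝ)
        (μ L Lbar p : ℝ) (q : Params) (zs : Vec d) (z0 y0 : Stack M d),
        ProperLscConvex g →
        0 < μ → 0 < L → 0 < Lbar →
        LipschitzAssumption F L Lbar →
        StronglyMonotone F μ →
        SolvesVI (globalOp F) g zs →
        G.Connected →
        IsGossipMatrix G W →
        1 ≤ b → b ≤ n →
        0 < p → p ≤ 1 / 8 →
        q.IsTuned μ L Lbar (charNumber W) p b →
        (∀ m, g (z0 m) ≠ ⊤) →
        y0 ∈ (consensus M d)ᗮ →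
        ∃ R : ℝ, 0 < R ∧
          ∀ (Ω : Type*) [MeasurableSpace Ω] (P : Measure Ω) [IsProbabilityMeasure P]
            (J J' : ℕ → Fin M → Fin b → Ω → Fin n) (ξ : ℕ → Ω → Bool)
            (z w y : ℕ → Ω → Stack M d),
            IsSampling P p J J' ξ →
            IsRun F g W q z0 y0 J J' ξ z w y →
            ∀ ε : ℝ, 0 < ε → ∀ k : ℕ,
              C * (1 / p + charNumber W + 1 / √(p * b) * (Lbar / μ)
                  + √(charNumber W) * (L / μ)) * Real.log (R / ε) ≤ k →
              Integrable (fun ω => ‖z k ω - diag M zs‖ ^ 2) P ∧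
                ∫ ω, ‖z k ω - diag M zs‖ ^ 2 ∂P ≤ ε := by
  refine ⟨64, by norm_num, ?_⟩
  intro d M n b F g G W μ L Lbar p q zs z0 y0 hg hμ hL hLb hF hmono hVI hG hW hb hbn hp hp8 hq _ hy0
  have hM : 0 < M := Fin.pos_iff_nonempty.2 hG.nonempty
  have hn : 0 < n := hb.trans hbn
  have hχ := hW.one_le_charNumber
  -- For d = 0 the comparison μ ≤ L may fail, but all iterates coincide with the solution.
  rcases Nat.eq_zero_or_pos d with rfl | hd
  · refine ⟨1, one_pos, ?_⟩
    intro Ω _ P _ J J' ξ z w y _ _ ε hε k _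
    have h0 : ∀ ω, ‖z k ω - diag M zs‖ ^ 2 = 0 := by
      intro ω
      have : z k ω = diag M zs := by
        ext i c
        exact c.elim0
      simp [this]
    simp [h0, hε.le]
  have hμL := modulus_le_lipschitz hM hd hF hmono
  have ha := hq.admissible hμ hL hLb hμL hχ hb hp hp8
  have hα0 : 0 ≤ q.α := by linarith [ha.alpha_eta, ha.eta_mu]
  obtain ⟨N, hN⟩ := hW.exists_dualNorm (d := d)
  have hy0' : y0 - dualSolution F zs ∈ (gossipLin d W).range := by
    rw [hW.range_gossipLin]
    exact Submodule.sub_mem _ hy0 (dualSolution_mem hM zs)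
  set Ψ0 := lyapunov F N q μ (diag M zs) (dualSolution F zs) z0 z0 z0 z0 y0 y0 with hΨ0
  have hΨ0_nonneg : 0 ≤ Ψ0 := le_trans (by positivity)
    (half_norm_sq_le_lyapunov hF hL.le hμ.le ha hW hN hy0' (diag M zs))
  -- The factor 2 undoes the 1/2 in `half_norm_sq_le_lyapunov`; adding 1 keeps R positive when the
  -- start is optimal.
  refine ⟨2 * Ψ0 + 1, by positivity, ?_⟩
  intro Ω _ P _ J J' ξ z w y hS hrun ε hε k hk
  have hint := hrun.integrable_norm_sq hS hM hn hg ha.eta_pos hp (by linarith) (diag M zs) k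
  refine ⟨hint, ?_⟩
  obtain ⟨hLi, hLe⟩ := hrun.expected_lyapunov_le hS hM hb hn hg hF hL.le hμ.le hmono hVI hW ha hN
    hy0' k
  have h1 : ∫ ω, ‖z k ω - diag M zs‖ ^ 2 ∂P ≤ ∫ ω, 2 * runLyapunov F N q μ (diag M zs)
      (dualSolution F zs) z w y k ω ∂P := by
    refine integral_mono hint (hLi.const_mul 2) fun ω => ?_
    have := half_norm_sq_le_lyapunov hF hL.le hμ.le ha hW hN (z := z k ω) (zm := z (k - 1) ω)
      (w := w k ω) (wm := w (k - 1) ω) (ym := y (k - 1) ω)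
      (hrun.y_sub_mem_range hy0' k ω) (diag M zs)
    simp only [runLyapunov]
    linarith
  rw [integral_const_mul] at h1
  have h2 := mul_pow_le_of_log_le (k := k) hα0 ha.alpha_le
    (hq.one_le_complexity_mul hμ hL hLb hμL hχ hb hp hp8) (R := 2 * Ψ0 + 1) (by positivity) hε hk
  have h3 : 0 ≤ q.α ^ k := by positivity
  linarith
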